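/- Let $\Psi$ be the set of all increasing (in the wide sense), continuous, concave functions $\psi$ on $[0,1]$ with $\psi(0)=0$ and $\psi\not\equiv 0$. For a random variable $f$ on a probability space $(\Omega,P)$ put $f^*(t)=\inf\{s\ge 0: P(|f|>s)\le t\}$ and $\|f\|_{\Lambda(\psi)}=\int_0^1 f^*(t)\,d\psi(t)$; the Lorentz space $\Lambda(\psi)(\Omega,P)$ consists of all measurable real $f$ for which this is finite, and $\Lambda(\psi)$ denotes this space over $[0,1]$ with Lebesgue measure. Let $r$ be a centered Bernoulli variable on $[0,1]$ (values $\pm1$ with probability $\frac12$ each) and, for $n\ge 1$, let $A_n:\Lambda(\psi)\to\Lambda(\psi)([0,1]^{2n})$ be the operator $$(A_nf)(s_1,t_1,\dots,s_n,t_n)=\sum_{k=1}^n f(s_k)\,r(t_k),$$ with operator norm $\|A_n\|$. Then for every $\psi\in\Psi$ exactly one of the following two alternatives holds. 1. There exist $q\in[\frac12,1)$ and $C>0$ such that $\|A_n\|\le C\,n^q$ for all $n\ge1$. 2. Either for every integer $k\ge1$, $\displaystyle\limsup_{u\to0+}\frac{\psi(ku)}{\psi(u)}=k$, or for every integer $l\ge1$,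 $\displaystyle\limsup_{u\to0+}\frac{\psi(u^l)}{\psi(u)}=1$ (or both). Moreover, for every $q\in[\frac12,1)$, there is $C>0$ with $\|A_n\|\le C\,n^q$ for all $n\ge1$ if and only if for every sequence $(\xi_k)_{k\ge1}\subset\Lambda(\psi)$ of independent identically distributed symmetric random variables on $[0,1]$ there is $C>0$ (which may depend on the sequence but not on $n$) such that $\big\|\sum_{k=1}^n\xi_k\big\|_{\Lambda(\psi)}\le C\,n^q$ for all $n\ge1$. -/

import Mathlib

open MeasureTheory ProbabilityTheory Filter Set Topology
open scoped ENNReal unitInterval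

/-- The class `Ψ` of (not identically zero) increasing continuous concave functions on `[0,1]`
vanishing at `0`. "Increasing" is in the wide sense. Only the values on `[0,1]` matter. -/
structure ConcaveWeight where
  toFun : ℝ → ℝ
  monotoneOn : MonotoneOn toFun (Icc 0 1)
  continuousOn : ContinuousOn toFun (Icc 0 1)
  concaveOn : ConcaveOn ℝ (Icc 0 1) toFun
  map_zero : toFun 0 = 0
  map_one_pos : 0 < toFun 1

instance : CoeFun ConcaveWeight (fun _ => ℝ → ℝ) := ⟨ConcaveWeight.toFun⟩

/-- `ψ`, extended by constants to the left of `0` and to the right of `1`, as a Stieltjes function;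
its measure is `dψ`. -/
noncomputable def ConcaveWeight.stieltjes (ψ : ConcaveWeight) : StieltjesFunction ℝ where
  toFun t := ψ (projIcc (0 : ℝ) 1 zero_le_one t)
  mono' s t h := ψ.monotoneOn (projIcc (0 : ℝ) 1 zero_le_one s).2
    (projIcc (0 : ℝ) 1 zero_le_one t).2 (monotone_projIcc zero_le_one h)
  right_continuous' t := by
    have h : Continuous fun t : ℝ => ψ (projIcc (0 : ℝ) 1 zero_le_one t) :=
      ψ.continuousOn.comp_continuous (continuous_subtype_val.comp continuous_projIcc)
        (fun t => (projIcc (0 : ℝ) 1 zero_le_one t).2)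
    exact h.continuousWithinAt

/-- The decreasing rearrangement `f*(t) = inf {s ≥ 0 : P(|f| > s) ≤ t}`. -/
noncomputable def rearrangement {Ω : Type*} [MeasurableSpace Ω] (P : Measure Ω) (f : Ω → ℝ)
    (t : ℝ) : ℝ≥0∞ :=
  sInf {s : ℝ≥0∞ | P {ω | s < ENNReal.ofReal |f ω|} ≤ ENNReal.ofReal t}

/-- The Lorentz norm `∫₀¹ f*(t) dψ(t)`, with value `∞` if `f` is not in the Lorentz space. -/
noncomputable def lorentzNorm (ψ : ConcaveWeight) {Ω : Type*} [MeasurableSpace Ω] (P : Measure Ω)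
    (f : Ω → ℝ) : ℝ≥0∞ :=
  ∫⁻ t in Ioc (0 : ℝ) 1, rearrangement P f t ∂ψ.stieltjes.measure

/-- Membership in the Lorentz space `Λ(ψ)(Ω, P)` (functions are not identified a.e.; all notions
below are invariant under a.e. equality). -/
def MemLorentz (ψ : ConcaveWeight) {Ω : Type*} [MeasurableSpace Ω] (P : Measure Ω)
    (f : Ω → ℝ) : Prop :=
  AEMeasurable f P ∧ lorentzNorm ψ P f < ∞

/-- A centered Bernoulli random variable on `[0,1]`. -/
noncomputable def bernoulliR (t : I) : ℝ := if (t : ℝ) ≤ 1 / 2 then 1 else -1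

/-- `A_n f = (f ⊗ r)₁ + ⋯ + (f ⊗ r)ₙ`, a function on the product of `n` copies of
`[0,1] × [0,1]`. -/
noncomputable def opA (n : ℕ) (f : I → ℝ) : (Fin n → I × I) → ℝ :=
  fun ω => ∑ k, f (ω k).1 * bernoulliR (ω k).2

/-- The norm of `A_n` as an operator from `Λ(ψ)[0,1]` to `Λ(ψ)([0,1]^{2n})`
(`∞` if `A_n` is not bounded). -/
noncomputable def opANorm (ψ : ConcaveWeight) (n : ℕ) : ℝ≥0∞ :=
  ⨆ (f : I → ℝ) (_ : MemLorentz ψ volume f) (_ : lorentzNorm ψ volume f ≤ 1),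
    lorentzNorm ψ volume (opA n f)

/-- `ξ` is a sequence of independent identically distributed symmetric random variables on
`[0,1]`, all of them in `Λ(ψ)`. -/
structure IsIIDSymmetric (ψ : ConcaveWeight) (ξ : ℕ → I → ℝ) : Prop where
  mem : ∀ k, MemLorentz ψ volume (ξ k)
  indep : iIndepFun ξ volume
  identDistrib : ∀ k, IdentDistrib (ξ k) (ξ 0) volume volume
  symmetric : ∀ k, IdentDistrib (ξ k) (fun t => -ξ k t) volume volume

/-! The Lorentz norm is a layer integral, `‖f‖ = ∫₀^∞ ψ(P(|f| > s)) ds`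
(`lorentzNorm_eq_lintegral_tail`), so it depends only on the law of `|f|`, and the law of `A_n f` is
the `n`-th convolution power of the symmetrised law of `f`. With the triangle inequality this gives
`‖A_n‖ ≤ n` and `‖A_(m+n)‖ ≤ ‖A_m‖ + ‖A_n‖`. Since `A_m f` is already symmetric, also `‖A_(mn)‖ ≤
‖A_m‖ ‖A_n‖` (`opANorm_mul_le`). Hence a single `m ≥ 2` with `‖A_m‖ < m` yields a bound `C n^q` with
`q < 1`, while such a bound forces `‖A_n‖ < n` for some `n`. The dichotomy thus asks when `‖A_n‖ =
n` for every `n ≥ 1`.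

By `opANorm_le_of_indicator` it suffices to test `A_n` on indicators of sets of measure `u`. With
`p_j = P(|A_n χ| > j)` one has `‖A_n χ‖ ≤ ∑_{j<n} ψ(p_j)` and `p_j ≤ (nu)^(j+1)`. For small `u` the
term `j = 0` sees `ψ(nu)`, and all but boundedly many of the others see at most `ψ(u^l)`. If both
limsup conditions fail, a large `n = k^m` makes the sum at most `(1 - ε) n ψ(u)` near `0`. Away from
`0`, Jensen and the cancellation of signs give a strict inequality, uniform by compactness
(`exists_opANorm_le_mul`). Conversely, exactly one hit has probability `n u (1-u)^(n-1)`, and `n`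
hits all with sign `+1` have probability `(u/2)^n`. If either limsup is extremal, one of these
events forces `‖A_n‖ ≥ n` (`nat_le_opANorm_of_limsup_mul`, `nat_le_opANorm_of_limsup_pow`).

For the equivalence with i.i.d. sequences, such sums have the norms of `A_n f`, and a gliding hump
of disjoint indicators turns bounds for each `f` into a bound for `‖A_n‖`
(`opANorm_le_rpow_of_pointwise`). -/

namespace ConcaveWeight

/-! ### Elementary properties of the weight. -/

variable (ψ : ConcaveWeight)

lemma mono {x y : ℝ} (hx : 0 ≤ x) (hxy : x ≤ y) (hy : y ≤ 1) : ψ x ≤ ψ y :=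
  ψ.monotoneOn ⟨hx, hxy.trans hy⟩ ⟨hx.trans hxy, hy⟩ hxy

lemma nonneg {x : ℝ} (hx : 0 ≤ x) (hx1 : x ≤ 1) : 0 ≤ ψ x := by
  have := ψ.mono le_rfl hx hx1
  rwa [ψ.map_zero] at this

lemma mul_le {θ x : ℝ} (hθ : 0 ≤ θ) (hθ1 : θ ≤ 1) (hx : 0 ≤ x) (hx1 : x ≤ 1) :
    θ * ψ x ≤ ψ (θ * x) := by
  have := ψ.concaveOn.2 (x := x) (y := 0) ⟨hx, hx1⟩ ⟨le_rfl, zero_le_one⟩ hθ (sub_nonneg.2 hθ1)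
    (by ring)
  simpa [ψ.map_zero] using this

lemma pos {x : ℝ} (hx : 0 < x) (hx1 : x ≤ 1) : 0 < ψ x := by
  have := ψ.mul_le hx.le hx1 zero_le_one le_rfl
  rw [mul_one] at this
  exact (mul_pos hx ψ.map_one_pos).trans_le this

lemma map_mul_le {k x : ℝ} (hk : 1 ≤ k) (hx : 0 ≤ x) (hkx : k * x ≤ 1) :
    ψ (k * x) ≤ k * ψ x := by
  have hk0 : 0 < k := by linarith
  have := ψ.mul_le (inv_nonneg.2 hk0.le) (inv_le_one_of_one_le₀ hk) (mul_nonneg hk0.le hx) hkx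
  rw [inv_mul_cancel_left₀ hk0.ne', inv_mul_le_iff₀ hk0] at this
  exact this

lemma stieltjes_apply {x : ℝ} (hx : 0 ≤ x) (hx1 : x ≤ 1) : ψ.stieltjes x = ψ x := by
  change ψ (projIcc (0 : ℝ) 1 zero_le_one x) = ψ x
  rw [projIcc_of_mem zero_le_one ⟨hx, hx1⟩]

lemma continuous_stieltjes : Continuous ψ.stieltjes :=
  ψ.continuousOn.comp_continuous (continuous_subtype_val.comp continuous_projIcc)
    (fun t => (projIcc (0 : ℝ) 1 zero_le_one t).2)

/-- The weight as a function of a measure of a set. -/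
noncomputable def tail (p : ℝ≥0∞) : ℝ≥0∞ := ENNReal.ofReal (ψ.stieltjes (min p 1).toReal)

lemma monotone_tail : Monotone ψ.tail := fun p q h => by
  refine ENNReal.ofReal_le_ofReal (ψ.stieltjes.mono ?_)
  exact ENNReal.toReal_mono (by simp) (min_le_min_right _ h)

lemma continuous_tail : Continuous ψ.tail := by
  refine ENNReal.continuous_ofReal.comp (ψ.continuous_stieltjes.comp ?_)
  refine ENNReal.continuousOn_toReal.comp_continuous (by fun_prop) fun p => ?_
  exact ((min_le_right p 1).trans_lt ENNReal.one_lt_top).ne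

lemma tail_ofReal {x : ℝ} (hx : 0 ≤ x) (hx1 : x ≤ 1) :
    ψ.tail (ENNReal.ofReal x) = ENNReal.ofReal (ψ x) := by
  have : ENNReal.ofReal x ≤ 1 := by simpa using hx1
  rw [tail, min_eq_left this, ENNReal.toReal_ofReal hx, ψ.stieltjes_apply hx hx1]

lemma tail_of_le_one {p : ℝ≥0∞} (hp : p ≤ 1) : ψ.tail p = ENNReal.ofReal (ψ p.toReal) := by
  have h : p ≠ ∞ := (hp.trans_lt ENNReal.one_lt_top).ne
  conv_lhs => rw [← ENNReal.ofReal_toReal h]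
  refine ψ.tail_ofReal ENNReal.toReal_nonneg ?_
  simpa using ENNReal.toReal_mono ENNReal.one_ne_top hp

lemma tail_zero : ψ.tail 0 = 0 := by
  rw [ψ.tail_of_le_one zero_le_one]; simp [ψ.map_zero]

lemma tail_ne_top (p : ℝ≥0∞) : ψ.tail p ≠ ∞ := ENNReal.ofReal_ne_top

/-- Continuity of `ψ` means that `dψ` has no atoms, so the open right endpoint costs nothing. -/
lemma measure_lt_eq_tail {p : ℝ≥0∞} (hp : p ≤ 1) :
    ψ.stieltjes.measure ({t : ℝ | ENNReal.ofReal t < p} ∩ Ioc 0 1) = ψ.tail p := by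
  have h : p ≠ ∞ := (hp.trans_lt ENNReal.one_lt_top).ne
  have h1 : p.toReal ≤ 1 := by simpa using ENNReal.toReal_mono ENNReal.one_ne_top hp
  have : {t : ℝ | ENNReal.ofReal t < p} ∩ Ioc 0 1 = Ioo 0 p.toReal := by
    ext t
    simp only [mem_inter_iff, mem_ofPred_eq, mem_Ioc, mem_Ioo]
    constructor
    · rintro ⟨h2, h3, -⟩
      exact ⟨h3, (ENNReal.ofReal_lt_iff_lt_toReal h3.le h).1 h2⟩
    · rintro ⟨h2, h3⟩
      exact ⟨(ENNReal.ofReal_lt_iff_lt_toReal h2.le h).2 h3, h2, h3.le.trans h1⟩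
  rw [this, StieltjesFunction.measure_Ioo, ψ.tail_of_le_one hp,
    ψ.continuous_stieltjes.continuousAt.continuousWithinAt.leftLim_eq,
    ψ.stieltjes_apply ENNReal.toReal_nonneg h1, ψ.stieltjes_apply le_rfl zero_le_one, ψ.map_zero,
    sub_zero]

end ConcaveWeight

/-! ### The layer-cake formula for the Lorentz norm. -/

section Layer

variable {Ω : Type*} [MeasurableSpace Ω] (P : Measure Ω)

lemma antitone_measure_lt_abs (f : Ω → ℝ) : Antitone fun s : ℝ => P {ω | s < |f ω|} :=
  fun _ _ h => measure_mono fun _ hω => lt_of_le_of_lt h hω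

lemma measurable_measure_lt_abs (f : Ω → ℝ) : Measurable fun s : ℝ => P {ω | s < |f ω|} :=
  (antitone_measure_lt_abs P f).measurable

/-- The set of levels `s > 0` with `t < P(|f| > s)` lies between `(0, f*(t))` and `(0, f*(t)]`, so
its length is `f*(t)`. This form of the rearrangement lets Tonelli exchange `s` and `t` in the norm.
-/
lemma rearrangement_eq_lintegral (f : Ω → ℝ) (t : ℝ) :
    rearrangement P f t =
      ∫⁻ s in Ioi (0 : ℝ), {s : ℝ | ENNReal.ofReal t < P {ω | s < |f ω|}}.indicator 1 s := by
  set R := rearrangement P f t with hR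
  set A := {s : ℝ | ENNReal.ofReal t < P {ω | s < |f ω|}} with hA
  have hAm : MeasurableSet A := measurableSet_lt measurable_const (measurable_measure_lt_abs P f)
  have hset : ∀ s : ℝ, 0 < s → {ω | ENNReal.ofReal s < ENNReal.ofReal |f ω|} = {ω | s < |f ω|} := by
    intro s hs
    ext ω
    simp [ENNReal.ofReal_lt_ofReal_iff_of_nonneg hs.le]
  have h1 : {s : ℝ | 0 < s ∧ ENNReal.ofReal s < R} ⊆ A ∩ Ioi 0 := by
    rintro s ⟨hs, hsR⟩
    refine ⟨?_, hs⟩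
    by_contra hcon
    refine absurd hsR (not_lt.2 (sInf_le ?_))
    rw [mem_ofPred_eq, hset s hs]
    exact not_lt.1 hcon
  have h2 : A ∩ Ioi 0 ⊆ {s : ℝ | 0 < s ∧ ENNReal.ofReal s ≤ R} := by
    rintro s ⟨hsA, hs⟩
    refine ⟨hs, le_sInf fun s' hs' => ?_⟩
    by_contra hcon
    have hlt := not_le.1 hcon
    refine absurd hsA (not_lt.2 (le_trans (measure_mono ?_) hs'))
    rw [← hset s hs]
    exact fun ω hω => hlt.trans hω
  rw [lintegral_indicator_one hAm, Measure.restrict_apply hAm]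
  refine le_antisymm ?_ ?_
  · refine le_trans ?_ (measure_mono h1)
    by_cases hRt : R = ∞
    · have : {s : ℝ | 0 < s ∧ ENNReal.ofReal s < R} = Ioi 0 := by
        ext s; simp [hRt]
      rw [this]; simp
    · have : {s : ℝ | 0 < s ∧ ENNReal.ofReal s < R} = Ioo 0 R.toReal := by
        ext s
        simp only [mem_ofPred_eq, mem_Ioo]
        exact and_congr_right fun hs => ENNReal.ofReal_lt_iff_lt_toReal hs.le hRt
      rw [this]; simp [hRt]
  · refine le_trans (measure_mono h2) ?_
    by_cases hRt : R = ∞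
    · simp [hRt]
    · have : {s : ℝ | 0 < s ∧ ENNReal.ofReal s ≤ R} = Ioc 0 R.toReal := by
        ext s
        simp only [mem_ofPred_eq, mem_Ioc]
        exact and_congr_right fun hs => ENNReal.ofReal_le_iff_le_toReal hRt
      rw [this]; simp [hRt]

/-- The Lorentz norm as an integral over the levels of the function. -/
lemma lorentzNorm_eq_lintegral_tail (ψ : ConcaveWeight) [IsProbabilityMeasure P] (f : Ω → ℝ) :
    lorentzNorm ψ P f = ∫⁻ s in Ioi (0 : ℝ), ψ.tail (P {ω | s < |f ω|}) := by
  simp only [lorentzNorm, rearrangement_eq_lintegral]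
  have hm : MeasurableSet {p : ℝ × ℝ | ENNReal.ofReal p.1 < P {ω | p.2 < |f ω|}} :=
    measurableSet_lt (by fun_prop) ((measurable_measure_lt_abs P f).comp measurable_snd)
  rw [lintegral_lintegral_swap]
  · refine lintegral_congr fun s => ?_
    have hs : MeasurableSet {t : ℝ | ENNReal.ofReal t < P {ω | s < |f ω|}} :=
      measurableSet_lt (by fun_prop) measurable_const
    rw [← ψ.measure_lt_eq_tail prob_le_one, ← Measure.restrict_apply hs,
      ← lintegral_indicator_one hs]
    rfl
  · exact (measurable_one.indicator hm).aemeasurable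

lemma lorentzNorm_congr_measure {Ω' : Type*} [MeasurableSpace Ω'] {P' : Measure Ω'}
    [IsProbabilityMeasure P] [IsProbabilityMeasure P'] (ψ : ConcaveWeight) {f : Ω → ℝ}
    {g : Ω' → ℝ} (h : ∀ s : ℝ, 0 < s → P {ω | s < |f ω|} = P' {ω | s < |g ω|}) :
    lorentzNorm ψ P f = lorentzNorm ψ P' g := by
  rw [lorentzNorm_eq_lintegral_tail, lorentzNorm_eq_lintegral_tail]
  exact setLIntegral_congr_fun measurableSet_Ioi fun s hs => by rw [h s hs]

lemma lorentzNorm_congr_ae [IsProbabilityMeasure P] (ψ : ConcaveWeight) {f g : Ω → ℝ}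
    (h : f =ᵐ[P] g) : lorentzNorm ψ P f = lorentzNorm ψ P g :=
  lorentzNorm_congr_measure P ψ fun s _ => measure_congr <| by
    filter_upwards [h] with ω hω
    change (s < |f ω|) = (s < |g ω|)
    rw [hω]

lemma lorentzNorm_const_mul [IsProbabilityMeasure P] (ψ : ConcaveWeight) {c : ℝ} (hc : 0 < c)
    (f : Ω → ℝ) :
    lorentzNorm ψ P (fun ω => c * f ω) = ENNReal.ofReal c * lorentzNorm ψ P f := by
  have hR : ∀ t, rearrangement P (fun ω => c * f ω) t = ENNReal.ofReal c * rearrangement P f t := by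
    intro t
    have hc0 : ENNReal.ofReal c ≠ 0 := by simpa using hc
    have key : ∀ s : ℝ≥0∞, {ω | ENNReal.ofReal c * s < ENNReal.ofReal |c * f ω|} =
        {ω | s < ENNReal.ofReal |f ω|} := by
      intro s
      ext ω
      rw [mem_ofPred_eq, mem_ofPred_eq, abs_mul, abs_of_pos hc, ENNReal.ofReal_mul hc.le,
        ENNReal.mul_lt_mul_iff_right hc0 ENNReal.ofReal_ne_top]
    have hinv : ∀ s : ℝ≥0∞, ENNReal.ofReal c * ((ENNReal.ofReal c)⁻¹ * s) = s := fun s => by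
      rw [← mul_assoc, ENNReal.mul_inv_cancel hc0 ENNReal.ofReal_ne_top, one_mul]
    refine le_antisymm ?_ ?_
    · rw [mul_comm, ← ENNReal.div_le_iff_le_mul (.inl hc0) (.inl ENNReal.ofReal_ne_top)]
      refine le_sInf fun s hs => ?_
      rw [ENNReal.div_le_iff_le_mul (.inl hc0) (.inl ENNReal.ofReal_ne_top)]
      refine sInf_le ?_
      rw [mem_ofPred_eq, mul_comm s, key]
      exact hs
    · refine le_sInf fun s hs => ?_
      rw [← hinv s]
      gcongr
      refine sInf_le ?_
      rw [mem_ofPred_eq, ← hinv s, key] at hs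
      exact hs
  simp only [lorentzNorm, hR]
  exact lintegral_const_mul' _ _ ENNReal.ofReal_ne_top

end Layer

/-! ### Subadditivity of the truncated layer integrals. -/

section Truncated

variable {Ω : Type*} [MeasurableSpace Ω] {P : Measure Ω}

/-- `ENNReal.ofReal` does the truncation: the left side is the integral of `(|f| - c)⁺`. -/
lemma lintegral_abs_sub_eq {f : Ω → ℝ} (hf : AEMeasurable f P) (c : ℝ) :
    ∫⁻ ω, ENNReal.ofReal (|f ω| - c) ∂P = ∫⁻ s in Ioi c, P {ω | s < |f ω|} := by
  have h1 : ∫⁻ ω, ENNReal.ofReal (|f ω| - c) ∂P = ∫⁻ ω, ENNReal.ofReal (max (|f ω| - c) 0) ∂P :=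
    lintegral_congr fun ω => by simp
  have h2 := (measurePreserving_add_right (volume : Measure ℝ) c).setLIntegral_comp_preimage
    (measurableSet_Ioi (a := c)) (measurable_measure_lt_abs P f)
  rw [h1, lintegral_eq_lintegral_meas_lt P (f := fun ω => max (|f ω| - c) 0)
      (ae_of_all _ fun ω => le_max_right _ _)
    ((hf.abs.sub_const c).max aemeasurable_const), ← h2]
  have h3 : (fun x => x + c) ⁻¹' Ioi c = Ioi 0 := by ext x; simp
  rw [h3]
  refine setLIntegral_congr_fun measurableSet_Ioi fun t (ht : 0 < t) => ?_
  congr 1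
  ext ω
  simp [lt_sub_iff_add_lt, ht.not_gt]

lemma lintegral_Ioi_zero_eq_add {c : ℝ} (hc : 0 ≤ c) (F : ℝ → ℝ≥0∞) :
    ∫⁻ s in Ioi (0 : ℝ), F s = (∫⁻ s in Ioc 0 c, F s) + ∫⁻ s in Ioi c, F s := by
  rw [← Ioc_union_Ioi_eq_Ioi hc, lintegral_union measurableSet_Ioi]
  exact disjoint_left.2 fun x hx hx' => not_lt.2 hx.2 hx'

/-- Together with `exists_lintegral_min_measure_ge`, this identifies the truncated layer integral
with a K-functional, the minimum over `c ≥ 0` of `c a + ∫ (|f| - c)⁺`. Here `a` is used as the bound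
below level `c` and the probability above it. -/
lemma lintegral_min_measure_le {f : Ω → ℝ} (hf : AEMeasurable f P) {c : ℝ} (hc : 0 ≤ c)
    (a : ℝ≥0∞) :
    ∫⁻ s in Ioi (0 : ℝ), min (P {ω | s < |f ω|}) a ≤
      ENNReal.ofReal c * a + ∫⁻ ω, ENNReal.ofReal (|f ω| - c) ∂P := by
  rw [lintegral_Ioi_zero_eq_add hc, lintegral_abs_sub_eq hf]
  refine add_le_add ?_ (lintegral_mono fun s => min_le_left _ _)
  calc _ ≤ ∫⁻ s in Ioc (0 : ℝ) c, a := lintegral_mono fun s => min_le_right _ _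
    _ = _ := by simp [mul_comm]

/-- The optimal level is `f*(a)`, the infimum of `S`: below it the minimum equals `a`, above it the
probability. Positivity of `a` makes `S` nonempty. -/
lemma exists_lintegral_min_measure_ge [IsFiniteMeasure P] {f : Ω → ℝ} (hf : AEMeasurable f P)
    {a : ℝ≥0∞} (ha : 0 < a) :
    ∃ c : ℝ, 0 ≤ c ∧ ENNReal.ofReal c * a + ∫⁻ ω, ENNReal.ofReal (|f ω| - c) ∂P ≤
      ∫⁻ s in Ioi (0 : ℝ), min (P {ω | s < |f ω|}) a := by
  set S : Set ℝ := {s | 0 ≤ s ∧ P {ω | s < |f ω|} ≤ a} with hS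
  have hbdd : BddBelow S := ⟨0, fun s hs => hs.1⟩
  have hne : S.Nonempty := by
    have hlim := tendsto_measure_iInter_atTop (μ := P) (s := fun n : ℕ => {ω | (n : ℝ) < |f ω|})
      (fun n => nullMeasurableSet_lt aemeasurable_const hf.abs)
      (fun m n hmn ω (hω : (n : ℝ) < |f ω|) => lt_of_le_of_lt (Nat.cast_le.2 hmn) hω)
      ⟨0, measure_ne_top _ _⟩
    have hempty : ⋂ n : ℕ, {ω | (n : ℝ) < |f ω|} = ∅ := by
      refine eq_empty_iff_forall_notMem.2 fun ω hω => ?_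
      obtain ⟨n, hn⟩ := exists_nat_ge |f ω|
      exact absurd (mem_iInter.1 hω n) (not_lt.2 hn)
    rw [hempty, measure_empty] at hlim
    obtain ⟨n, hn⟩ := (hlim.eventually (gt_mem_nhds ha)).exists
    exact ⟨n, n.cast_nonneg, hn.le⟩
  have hc : 0 ≤ sInf S := le_csInf hne fun s hs => hs.1
  refine ⟨sInf S, hc, ?_⟩
  rw [lintegral_Ioi_zero_eq_add hc, lintegral_abs_sub_eq hf]
  refine add_le_add ?_ ?_
  · calc ENNReal.ofReal (sInf S) * a = ∫⁻ s in Ioo (0 : ℝ) (sInf S), a := by simp [mul_comm]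
      _ ≤ ∫⁻ s in Ioo (0 : ℝ) (sInf S), min (P {ω | s < |f ω|}) a := by
        refine setLIntegral_mono' measurableSet_Ioo fun s hs => le_min ?_ le_rfl
        by_contra hcon
        exact absurd (csInf_le hbdd ⟨hs.1.le, (not_le.1 hcon).le⟩) (not_le.2 hs.2)
      _ ≤ _ := lintegral_mono_set Ioo_subset_Ioc_self
  · refine setLIntegral_mono' measurableSet_Ioi fun s (hs : sInf S < s) => le_min le_rfl ?_
    obtain ⟨r, hr, hrs⟩ := exists_lt_of_csInf_lt hne hs
    exact (antitone_measure_lt_abs P f hrs.le).trans hr.2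

/-- If `c` and `d` are optimal levels for `f` and `g`, then `c + d` is a competitor for `f + g`,
because `(|f + g| - c - d)⁺ ≤ (|f| - c)⁺ + (|g| - d)⁺`. -/
lemma lintegral_min_measure_add_le [IsFiniteMeasure P] {f g : Ω → ℝ} (hf : AEMeasurable f P)
    (hg : AEMeasurable g P) (a : ℝ≥0∞) :
    ∫⁻ s in Ioi (0 : ℝ), min (P {ω | s < |f ω + g ω|}) a ≤
      (∫⁻ s in Ioi (0 : ℝ), min (P {ω | s < |f ω|}) a) +
        ∫⁻ s in Ioi (0 : ℝ), min (P {ω | s < |g ω|}) a := by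
  rcases eq_or_ne a 0 with rfl | ha
  · simp
  obtain ⟨c, hc, hfc⟩ := exists_lintegral_min_measure_ge hf (pos_iff_ne_zero.2 ha)
  obtain ⟨d, hd, hgd⟩ := exists_lintegral_min_measure_ge hg (pos_iff_ne_zero.2 ha)
  refine (lintegral_min_measure_le (hf.add hg) (add_nonneg hc hd) a).trans
    (le_trans ?_ (add_le_add hfc hgd))
  rw [ENNReal.ofReal_add hc hd, add_mul, add_add_add_comm,
    ← lintegral_add_left' (hf.abs.sub_const c).ennreal_ofReal]
  gcongr with ω
  refine le_trans (ENNReal.ofReal_le_ofReal ?_) ENNReal.ofReal_add_le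
  have := abs_add_le (f ω) (g ω)
  simp only [Pi.add_apply]
  linarith

end Truncated

/-! ### Concave weights as limits of positive combinations of `x ↦ min x a`. -/

lemma sum_secondDiff_mul_min (b : ℕ → ℝ) (hb : b 0 = 0) {j M : ℕ} (h : j ≤ M) :
    ∑ i ∈ Finset.range M, (2 * b (i + 1) - b i - b (i + 2)) * min ((i : ℝ) + 1) j =
      b j - j * (b (M + 1) - b M) := by
  induction M, h using Nat.le_induction with
  | base =>
    have : ∀ M ≤ j, ∑ i ∈ Finset.range M, (2 * b (i + 1) - b i - b (i + 2)) * min ((i : ℝ) + 1) j =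
        (M + 1) * b M - M * b (M + 1) := by
      intro M hM
      induction M with
      | zero => simp [hb]
      | succ M ih =>
        have h1 : (M : ℝ) + 1 ≤ j := by exact_mod_cast hM
        rw [Finset.sum_range_succ, ih (by omega), min_eq_left h1]
        push_cast
        ring
    rw [this j le_rfl]
    ring
  | succ M hM ih =>
    have h1 : (j : ℝ) ≤ (M : ℝ) + 1 := by exact_mod_cast hM.trans (Nat.le_succ M)
    rw [Finset.sum_range_succ, ih, min_eq_right h1]
    ring

namespace ConcaveWeight

variable (ψ : ConcaveWeight)

/-- The coefficients of the piecewise linear interpolation of the weight at the points `i / N`. -/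
noncomputable def interpCoeff (N i : ℕ) : ℝ :=
  N * (2 * ψ (min (((i + 1 : ℕ) : ℝ) / N) 1) - ψ (min ((i : ℝ) / N) 1) -
    ψ (min (((i + 2 : ℕ) : ℝ) / N) 1))

/-- Clipping the nodes at `1` turns the last coefficient into a plain increment of `ψ`. The midpoint
of `i / N` and the clipped node `z` is at most `(i + 1) / N`, so midpoint concavity followed by
monotonicity covers every `i` at once. -/
lemma interpCoeff_nonneg {N i : ℕ} (hi : i < N) : 0 ≤ ψ.interpCoeff N i := by
  have hN : (0 : ℝ) < N := by exact_mod_cast (Nat.zero_le i).trans_lt hi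
  have hi1 : ((i + 1 : ℕ) : ℝ) / N ≤ 1 := by rw [div_le_one hN]; exact_mod_cast hi
  have hi0 : (i : ℝ) / N ≤ ((i + 1 : ℕ) : ℝ) / N := by gcongr; simp
  refine mul_nonneg hN.le ?_
  rw [min_eq_left hi1, min_eq_left (hi0.trans hi1)]
  set z := min (((i + 2 : ℕ) : ℝ) / N) 1
  have hz0 : ((i + 1 : ℕ) : ℝ) / N ≤ z := le_min (by gcongr; simp) hi1
  have hz2 : z ≤ ((i + 2 : ℕ) : ℝ) / N := min_le_left _ _
  have hi00 : 0 ≤ (i : ℝ) / N := by positivity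
  have h1 := ψ.concaveOn.2 (x := (i : ℝ) / N) (y := z) ⟨hi00, hi0.trans hi1⟩
    ⟨hi00.trans (hi0.trans hz0), min_le_right _ _⟩ (show (0 : ℝ) ≤ 1 / 2 by norm_num)
    (show (0 : ℝ) ≤ 1 / 2 by norm_num) (by norm_num)
  have h2 : (1 / 2 : ℝ) • ((i : ℝ) / N) + (1 / 2 : ℝ) • z ≤ ((i + 1 : ℕ) : ℝ) / N := by
    have h3 : ((i + 2 : ℕ) : ℝ) / N = 2 * (((i + 1 : ℕ) : ℝ) / N) - (i : ℝ) / N := by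
      push_cast; ring
    simp only [smul_eq_mul]
    linarith
  have h4 := ψ.mono (by simp only [smul_eq_mul]; linarith) h2 hi1
  simp only [smul_eq_mul] at h1 h4
  linarith

/-- The piecewise linear interpolation of the weight at the points `i / N`. -/
noncomputable def interp (N : ℕ) (x : ℝ) : ℝ :=
  ∑ i ∈ Finset.range N, ψ.interpCoeff N i * min x (((i + 1 : ℕ) : ℝ) / N)

lemma interp_natCast_div {N j : ℕ} (hN : 0 < N) (hj : j ≤ N) :
    ψ.interp N ((j : ℝ) / N) = ψ ((j : ℝ) / N) := by
  have hN' : (0 : ℝ) < N := by exact_mod_cast hN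
  have h := sum_secondDiff_mul_min (fun i => ψ (min ((i : ℝ) / N) 1)) (by simp [ψ.map_zero]) hj
  have h1 : ((N + 1 : ℕ) : ℝ) / N ≥ 1 := by
    rw [ge_iff_le, one_le_div hN']; exact_mod_cast N.le_succ
  have h2 : (j : ℝ) / N ≤ 1 := by rw [div_le_one hN']; exact_mod_cast hj
  simp only [min_eq_right h1, div_self hN'.ne', min_self, sub_self, mul_zero, sub_zero,
    min_eq_left h2] at h
  rw [← h]
  refine Finset.sum_congr rfl fun i _ => ?_
  have : min ((j : ℝ) / N) (((i + 1 : ℕ) : ℝ) / N) = min ((i : ℝ) + 1) j / N := by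
    rw [min_comm, ← min_div_div_right hN'.le]; push_cast; rfl
  rw [this, interpCoeff]
  field_simp

lemma interp_mono (N : ℕ) {x y : ℝ} (h : x ≤ y) : ψ.interp N x ≤ ψ.interp N y := by
  refine Finset.sum_le_sum fun i hi => ?_
  exact mul_le_mul_of_nonneg_left (min_le_min_right _ h)
    (ψ.interpCoeff_nonneg (Finset.mem_range.1 hi))

lemma floor_mul_le {N : ℕ} {x : ℝ} (hx1 : x ≤ 1) : ⌊N * x⌋₊ ≤ N := by
  refine Nat.floor_le_of_le ?_
  nlinarith [Nat.cast_nonneg (α := ℝ) N]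

/-- Every summand `min x ((i + 1) / N)` is affine between consecutive nodes, so the interpolation is
the chord there, and a concave graph lies above its chords. -/
lemma interp_le {N : ℕ} (hN : 0 < N) {x : ℝ} (hx : 0 ≤ x) (hx1 : x ≤ 1) :
    ψ.interp N x ≤ ψ x := by
  have hN' : (0 : ℝ) < N := by exact_mod_cast hN
  set j := ⌊N * x⌋₊ with hj
  have hjx : (j : ℝ) ≤ N * x := Nat.floor_le (by positivity)
  have hjx' : N * x < j + 1 := Nat.lt_floor_add_one _
  rcases eq_or_lt_of_le (floor_mul_le (N := N) hx1) with hjN | hjN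
  · have : x = (N : ℝ) / N := by
      rw [div_self hN'.ne']
      refine le_antisymm hx1 ?_
      rw [← hj] at hjN
      rw [hjN] at hjx
      exact le_of_mul_le_mul_left (by linarith) hN'
    rw [this, ψ.interp_natCast_div hN le_rfl]
  · set θ : ℝ := N * x - j with hθ
    have hx2 : x = (1 - θ) * ((j : ℝ) / N) + θ * (((j + 1 : ℕ) : ℝ) / N) := by
      push_cast
      field_simp
      ring
    have h1 : ψ.interp N x =
        (1 - θ) * ψ.interp N ((j : ℝ) / N) + θ * ψ.interp N (((j + 1 : ℕ) : ℝ) / N) := by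
      simp only [interp, Finset.mul_sum]
      rw [← Finset.sum_add_distrib]
      refine Finset.sum_congr rfl fun i _ => ?_
      have : min x (((i + 1 : ℕ) : ℝ) / N) =
          (1 - θ) * min ((j : ℝ) / N) (((i + 1 : ℕ) : ℝ) / N) +
            θ * min (((j + 1 : ℕ) : ℝ) / N) (((i + 1 : ℕ) : ℝ) / N) := by
        have hxj : (j : ℝ) / N ≤ x := by rw [div_le_iff₀ hN']; linarith
        have hxj' : x ≤ ((j + 1 : ℕ) : ℝ) / N := by
          rw [le_div_iff₀ hN']; push_cast; linarith
        rcases le_or_gt j i with hij | hij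
        · have h3 : ((j + 1 : ℕ) : ℝ) / N ≤ ((i + 1 : ℕ) : ℝ) / N := by gcongr
          rw [min_eq_left (hxj'.trans h3), min_eq_left (hxj.trans (hxj'.trans h3)),
            min_eq_left h3, ← hx2]
        · have h3 : ((i + 1 : ℕ) : ℝ) / N ≤ (j : ℝ) / N := by gcongr; omega
          rw [min_eq_right h3, min_eq_right (h3.trans hxj), min_eq_right (h3.trans (hxj.trans hxj'))]
          ring
      rw [this]
      ring
    have hj1 : ((j + 1 : ℕ) : ℝ) / N ≤ 1 := by rw [div_le_one hN']; exact_mod_cast hjN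
    have hj0 : (j : ℝ) / N ≤ 1 := le_trans (by gcongr; simp) hj1
    rw [h1, ψ.interp_natCast_div hN hjN.le, ψ.interp_natCast_div hN hjN]
    have := ψ.concaveOn.2 (x := (j : ℝ) / N) (y := ((j + 1 : ℕ) : ℝ) / N)
      ⟨by positivity, hj0⟩ ⟨by positivity, hj1⟩ (show 0 ≤ 1 - θ by rw [hθ]; linarith)
      (show 0 ≤ θ by rw [hθ]; linarith) (by ring)
    simp only [smul_eq_mul] at this
    rwa [← hx2] at this

lemma tendsto_interp {x : ℝ} (hx : 0 ≤ x) (hx1 : x ≤ 1) :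
    Tendsto (fun N : ℕ => ψ.interp (N + 1) x) atTop (𝓝 (ψ x)) := by
  have hlim : Tendsto (fun N : ℕ => ((⌊((N + 1 : ℕ) : ℝ) * x⌋₊ : ℕ) : ℝ) / ((N + 1 : ℕ) : ℝ))
      atTop (𝓝 x) := by
    have h := (tendsto_nat_floor_mul_div_atTop hx).comp
      ((tendsto_natCast_atTop_atTop (R := ℝ)).comp (tendsto_add_atTop_nat 1))
    refine h.congr fun N => ?_
    simp [mul_comm]
  have hmem : ∀ N : ℕ,
      ((⌊((N + 1 : ℕ) : ℝ) * x⌋₊ : ℕ) : ℝ) / ((N + 1 : ℕ) : ℝ) ∈ Icc (0 : ℝ) 1 := fun N =>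
    ⟨by positivity, by
      rw [div_le_one (by positivity)]; exact_mod_cast floor_mul_le hx1⟩
  have h1 : Tendsto (fun N : ℕ =>
      ψ (((⌊((N + 1 : ℕ) : ℝ) * x⌋₊ : ℕ) : ℝ) / ((N + 1 : ℕ) : ℝ))) atTop (𝓝 (ψ x)) :=
    (ψ.continuousOn x ⟨hx, hx1⟩).tendsto.comp
      (tendsto_nhdsWithin_iff.2 ⟨hlim, Eventually.of_forall hmem⟩)
  refine tendsto_of_tendsto_of_tendsto_of_le_of_le h1 tendsto_const_nhds (fun N => ?_)
    fun N => ψ.interp_le N.succ_pos hx hx1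
  simp only
  rw [← ψ.interp_natCast_div N.succ_pos (floor_mul_le hx1)]
  refine ψ.interp_mono _ ?_
  rw [div_le_iff₀ (by positivity), mul_comm x]
  exact Nat.floor_le (by positivity)

lemma ofReal_interp_toReal (N : ℕ) {p : ℝ≥0∞} (hp : p ≠ ∞) :
    ENNReal.ofReal (ψ.interp N p.toReal) = ∑ i ∈ Finset.range N,
      ENNReal.ofReal (ψ.interpCoeff N i) * min p (ENNReal.ofReal (((i + 1 : ℕ) : ℝ) / N)) := by
  rw [interp, ENNReal.ofReal_sum_of_nonneg]
  · refine Finset.sum_congr rfl fun i hi => ?_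
    rw [ENNReal.ofReal_mul (ψ.interpCoeff_nonneg (Finset.mem_range.1 hi)),
      ENNReal.ofReal_min, ENNReal.ofReal_toReal hp]
  · intro i hi
    exact mul_nonneg (ψ.interpCoeff_nonneg (Finset.mem_range.1 hi))
      (le_min ENNReal.toReal_nonneg (by positivity))

end ConcaveWeight

/-! ### Triangle inequality and Fatou property of the Lorentz norm. -/

section Norm

variable {Ω : Type*} [MeasurableSpace Ω] {P : Measure Ω} [IsProbabilityMeasure P]
  (ψ : ConcaveWeight)

lemma lintegral_interp_eq (N : ℕ) (f : Ω → ℝ) :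
    ∫⁻ s in Ioi (0 : ℝ), ENNReal.ofReal (ψ.interp N (P {ω | s < |f ω|}).toReal) =
      ∑ i ∈ Finset.range N, ENNReal.ofReal (ψ.interpCoeff N i) *
        ∫⁻ s in Ioi (0 : ℝ), min (P {ω | s < |f ω|}) (ENNReal.ofReal (((i + 1 : ℕ) : ℝ) / N)) := by
  have hm := measurable_measure_lt_abs P f
  simp only [ψ.ofReal_interp_toReal N (measure_ne_top P _)]
  rw [lintegral_finsetSum _ fun i _ => (hm.min measurable_const).const_mul _]
  exact Finset.sum_congr rfl fun i _ => lintegral_const_mul _ (hm.min measurable_const)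

lemma toReal_prob_le_one (A : Set Ω) : (P A).toReal ≤ 1 := by
  simpa using ENNReal.toReal_mono ENNReal.one_ne_top (prob_le_one (μ := P) (s := A))

lemma lintegral_interp_le (N : ℕ) (f : Ω → ℝ) :
    ∫⁻ s in Ioi (0 : ℝ), ENNReal.ofReal (ψ.interp (N + 1) (P {ω | s < |f ω|}).toReal) ≤
      lorentzNorm ψ P f := by
  rw [lorentzNorm_eq_lintegral_tail]
  refine lintegral_mono fun s => ?_
  rw [ψ.tail_of_le_one prob_le_one]
  exact ENNReal.ofReal_le_ofReal
    (ψ.interp_le N.succ_pos ENNReal.toReal_nonneg (toReal_prob_le_one _))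

/-- The triangle inequality in the Lorentz space. -/
lemma lorentzNorm_add_le {f g : Ω → ℝ} (hf : AEMeasurable f P) (hg : AEMeasurable g P) :
    lorentzNorm ψ P (fun ω => f ω + g ω) ≤ lorentzNorm ψ P f + lorentzNorm ψ P g := by
  have hlim : ∀ s : ℝ, ψ.tail (P {ω | s < |f ω + g ω|}) = liminf (fun N : ℕ =>
      ENNReal.ofReal (ψ.interp (N + 1) (P {ω | s < |f ω + g ω|}).toReal)) atTop := fun s => by
    rw [ψ.tail_of_le_one prob_le_one]
    exact ((ENNReal.tendsto_ofReal (ψ.tendsto_interp ENNReal.toReal_nonneg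
      (toReal_prob_le_one _))).liminf_eq).symm
  have hm := measurable_measure_lt_abs P fun ω => f ω + g ω
  rw [lorentzNorm_eq_lintegral_tail]
  simp only [hlim]
  -- Fatou in `N`. For fixed `N` the interpolated integral is a nonnegative combination of truncated
  -- layer integrals, each of them subadditive.
  refine (lintegral_liminf_le fun N => ?_).trans ?_
  · simp only [ψ.ofReal_interp_toReal _ (measure_ne_top P _)]
    exact Finset.measurable_fun_sum _ fun i _ => (hm.min measurable_const).const_mul _
  refine liminf_le_of_frequently_le' (Eventually.frequently (Eventually.of_forall fun N => ?_))
  refine le_trans ?_ (add_le_add (lintegral_interp_le ψ N f) (lintegral_interp_le ψ N g))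
  simp only [lintegral_interp_eq]
  rw [← Finset.sum_add_distrib]
  refine Finset.sum_le_sum fun i _ => ?_
  rw [← mul_add]
  gcongr
  exact lintegral_min_measure_add_le hf hg _

lemma lorentzNorm_zero : lorentzNorm ψ P (fun _ => 0) = 0 := by
  rw [lorentzNorm_eq_lintegral_tail]
  rw [setLIntegral_congr_fun (g := fun _ => 0) measurableSet_Ioi, lintegral_zero]
  intro s (hs : 0 < s)
  simp [hs.not_gt, ψ.tail_zero]

lemma lorentzNorm_sum_le {ι : Type*} (t : Finset ι) {f : ι → Ω → ℝ}
    (hf : ∀ i ∈ t, AEMeasurable (f i) P) :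
    lorentzNorm ψ P (fun ω => ∑ i ∈ t, f i ω) ≤ ∑ i ∈ t, lorentzNorm ψ P (f i) := by
  classical
  induction t using Finset.induction_on with
  | empty => simp [lorentzNorm_zero]
  | insert a t ha ih =>
    simp only [Finset.sum_insert ha]
    refine (lorentzNorm_add_le ψ (hf a (Finset.mem_insert_self a t)) ?_).trans ?_
    · exact Finset.aemeasurable_fun_sum t fun i hi => hf i (Finset.mem_insert_of_mem hi)
    · gcongr
      exact ih fun i hi => hf i (Finset.mem_insert_of_mem hi)

/-- The Fatou property of the Lorentz norm. -/
lemma lorentzNorm_le_liminf {f : ℕ → Ω → ℝ} {g : Ω → ℝ} (hf : ∀ n, AEMeasurable (f n) P)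
    (h : ∀ᵐ ω ∂P, Tendsto (fun n => f n ω) atTop (𝓝 (g ω))) :
    lorentzNorm ψ P g ≤ liminf (fun n => lorentzNorm ψ P (f n)) atTop := by
  have hg : AEMeasurable g P := aemeasurable_of_tendsto_metrizable_ae atTop hf h
  -- Where `s < |g|` holds, `s < |f n|` holds eventually, so Fatou applies to the indicators. Fatou
  -- is used a second time below, in the variable `s`, after moving the monotone continuous weight
  -- through the liminf.
  have hP : ∀ s : ℝ, P {ω | s < |g ω|} ≤ liminf (fun n => P {ω | s < |f n ω|}) atTop := by
    intro s
    have hn : ∀ n, NullMeasurableSet {ω | s < |f n ω|} P := fun n =>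
      nullMeasurableSet_lt aemeasurable_const (hf n).abs
    have hn' : NullMeasurableSet {ω | s < |g ω|} P := nullMeasurableSet_lt aemeasurable_const hg.abs
    simp only [← lintegral_indicator_one₀ hn', ← lintegral_indicator_one₀ (hn _)]
    refine le_trans (lintegral_mono_ae ?_)
      (lintegral_liminf_le' fun n => aemeasurable_one.indicator₀ (hn n))
    filter_upwards [h] with ω hω
    by_cases hs : s < |g ω|
    · refine le_liminf_of_le (by isBoundedDefault) ?_
      filter_upwards [hω.abs.eventually (lt_mem_nhds hs)] with n hns
      rw [indicator_of_mem (show ω ∈ {ω | s < |f n ω|} from hns)]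
      exact indicator_le_self' (fun _ _ => zero_le) ω
    · rw [indicator_of_notMem (by exact hs)]
      exact zero_le
  simp only [lorentzNorm_eq_lintegral_tail]
  refine le_trans (lintegral_mono fun s => ?_) (lintegral_liminf_le fun n =>
    ψ.continuous_tail.measurable.comp (measurable_measure_lt_abs P (f n)))
  refine (ψ.monotone_tail (hP s)).trans (le_of_eq ?_)
  exact ψ.monotone_tail.map_liminf_of_continuousAt _ ψ.continuous_tail.continuousAt

lemma lorentzNorm_abs (f : Ω → ℝ) : lorentzNorm ψ P (fun ω => |f ω|) = lorentzNorm ψ P f := by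
  simp only [lorentzNorm_eq_lintegral_tail, abs_abs]

/-- The Lorentz norm depends only on the law. -/
lemma lorentzNorm_map {f : Ω → ℝ} (hf : AEMeasurable f P) :
    lorentzNorm ψ (P.map f) id = lorentzNorm ψ P f := by
  have := Measure.isProbabilityMeasure_map hf
  refine lorentzNorm_congr_measure _ ψ fun s _ => ?_
  rw [Measure.map_apply_of_aemeasurable hf]
  · rfl
  · exact measurableSet_lt measurable_const (by fun_prop)

lemma lorentzNorm_indicator (E : Set Ω) :
    lorentzNorm ψ P (E.indicator fun _ => (1 : ℝ)) = ψ.tail (P E) := by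
  rw [lorentzNorm_eq_lintegral_tail, lintegral_Ioi_zero_eq_add zero_le_one,
    setLIntegral_congr_fun (g := fun _ => 0) (s := Ioi 1) measurableSet_Ioi, lintegral_zero,
    add_zero, ← setLIntegral_congr Ioo_ae_eq_Ioc,
    setLIntegral_congr_fun (g := fun _ => ψ.tail (P E)) measurableSet_Ioo]
  · simp
  · intro s hs
    dsimp only
    congr 2
    ext ω
    by_cases hω : ω ∈ E <;> simp [hω, hs.1.le, hs.2]
  · intro s (hs : 1 < s)
    dsimp only
    rw [show {ω | s < |E.indicator (fun _ => (1 : ℝ)) ω|} = ∅ from ?_, measure_empty, ψ.tail_zero]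
    refine eq_empty_iff_forall_notMem.2 fun ω hω => ?_
    by_cases hω' : ω ∈ E <;> simp [hω'] at hω <;> linarith

end Norm

/-! ### Symmetrised laws and convolution powers. -/

section Laws

/-- The law of the product of a random variable of law `ν` and an independent random sign. -/
noncomputable def symmLaw (ν : Measure ℝ) : Measure ℝ := (2 : ℝ≥0∞)⁻¹ • (ν + ν.map Neg.neg)

instance (ν : Measure ℝ) [IsProbabilityMeasure ν] : IsProbabilityMeasure (symmLaw ν) := by
  have := Measure.isProbabilityMeasure_map (μ := ν) measurable_neg.aemeasurable
  refine ⟨?_⟩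
  rw [symmLaw, Measure.smul_apply, Measure.add_apply, measure_univ, measure_univ, smul_eq_mul,
    one_add_one_eq_two, ENNReal.inv_mul_cancel two_ne_zero ENNReal.ofNat_ne_top]

lemma symmLaw_apply (ν : Measure ℝ) {B : Set ℝ} (hB : MeasurableSet B) :
    symmLaw ν B = 2⁻¹ * (ν B + ν (Neg.neg ⁻¹' B)) := by
  rw [symmLaw, Measure.smul_apply, Measure.add_apply, Measure.map_apply measurable_neg hB,
    smul_eq_mul]

lemma map_neg_symmLaw (ν : Measure ℝ) : (symmLaw ν).map Neg.neg = symmLaw ν := by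
  rw [symmLaw, Measure.map_smul, Measure.map_add _ _ measurable_neg,
    Measure.map_map measurable_neg measurable_neg]
  simp [add_comm]

lemma symmLaw_of_map_neg {ν : Measure ℝ} (h : ν.map Neg.neg = ν) : symmLaw ν = ν := by
  rw [symmLaw, h, ← two_smul ℝ≥0∞, smul_smul,
    ENNReal.inv_mul_cancel two_ne_zero ENNReal.ofNat_ne_top, one_smul]

/-- The law of a sum of `n` independent random variables of law `μ`. -/
noncomputable def convPow (μ : Measure ℝ) : ℕ → Measure ℝ
  | 0 => Measure.dirac 0
  | n + 1 => convPow μ n ∗ μ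

instance (μ : Measure ℝ) [IsProbabilityMeasure μ] (n : ℕ) : IsProbabilityMeasure (convPow μ n) := by
  induction n with
  | zero => exact Measure.dirac.isProbabilityMeasure
  | succ n ih =>
    rw [convPow]
    infer_instance

lemma convPow_add (μ : Measure ℝ) [IsProbabilityMeasure μ] (m n : ℕ) : convPow μ (m + n) = convPow μ m ∗ convPow μ n := by
  induction n with
  | zero => exact (Measure.conv_dirac_zero _).symm
  | succ n ih => rw [← add_assoc, convPow, ih, Measure.conv_assoc, convPow]

lemma convPow_mul (μ : Measure ℝ) [IsProbabilityMeasure μ] (m n : ℕ) : convPow μ (m * n) = convPow (convPow μ m) n := by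
  induction n with
  | zero => rfl
  | succ n ih => rw [Nat.mul_succ, convPow_add, ih, convPow]

lemma map_neg_convPow (μ : Measure ℝ) [IsProbabilityMeasure μ] (h : μ.map Neg.neg = μ) (n : ℕ) :
    (convPow μ n).map Neg.neg = convPow μ n := by
  have := Measure.isProbabilityMeasure_map (μ := μ) measurable_neg.aemeasurable
  induction n with
  | zero => simp [convPow]
  | succ n ih =>
    have h1 := Measure.map_conv_addMonoidHom (μ := convPow μ n) (ν := μ)
      (negAddMonoidHom : ℝ →+ ℝ) measurable_neg
    simp only [coe_negAddMonoidHom] at h1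
    rw [convPow, h1, ih, h]

lemma map_sum_eq_convPow (μ : Measure ℝ) {Ω ι : Type*} [MeasurableSpace Ω] {P : Measure Ω}
    [IsProbabilityMeasure P] {X : ι → Ω → ℝ} (hX : ∀ i, AEMeasurable (X i) P)
    (hind : iIndepFun X P) (hlaw : ∀ i, P.map (X i) = μ) (t : Finset ι) :
    P.map (fun ω => ∑ i ∈ t, X i ω) = convPow μ t.card := by
  classical
  induction t using Finset.induction_on with
  | empty => simp [convPow, Measure.map_const]
  | insert a t ha ih =>
    have h1 := (hind.indepFun_finsetSum_of_notMem₀ hX ha).map_add_eq_map_conv_map₀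
      (Finset.aemeasurable_sum t fun i _ => hX i) (hX a)
    have h2 : (fun ω => ∑ i ∈ insert a t, X i ω) = (∑ j ∈ t, X j) + X a := by
      ext ω
      simp [Finset.sum_insert ha, add_comm]
    have h3 : (fun ω => ∑ i ∈ t, X i ω) = ∑ j ∈ t, X j := by
      ext ω
      simp
    rw [h2, h1, ← h3, ih, hlaw, Finset.card_insert_of_notMem ha, convPow]

end Laws

/-! ### The law of `A_n f`, and sub-additivity and sub-multiplicativity of `‖A_n‖`. -/

section Operator

lemma measurable_bernoulliR : Measurable bernoulliR :=
  Measurable.ite (measurableSet_le (by fun_prop) (by fun_prop)) measurable_const measurable_const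

lemma volume_bernoulliR_pos : (volume : Measure I) {t : I | (t : ℝ) ≤ 1 / 2} = 2⁻¹ := by
  have h := unitInterval.volume_Iic ⟨1 / 2, by norm_num, by norm_num⟩
  have h2 : Iic (⟨1 / 2, by norm_num, by norm_num⟩ : I) = {t : I | (t : ℝ) ≤ 1 / 2} := rfl
  rw [← h2, h]
  simp [ENNReal.ofReal_inv_of_pos]

lemma volume_bernoulliR_neg : (volume : Measure I) {t : I | (t : ℝ) ≤ 1 / 2}ᶜ = 2⁻¹ := by
  rw [prob_compl_eq_one_sub (measurableSet_le (by fun_prop) (by fun_prop)), volume_bernoulliR_pos]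
  exact ENNReal.one_sub_inv_two

lemma aemeasurable_mul_bernoulliR {f : I → ℝ} (hf : AEMeasurable f volume) :
    AEMeasurable (fun p : I × I => f p.1 * bernoulliR p.2) volume :=
  (hf.comp_quasiMeasurePreserving Measure.quasiMeasurePreserving_fst).mul
    (measurable_bernoulliR.comp measurable_snd).aemeasurable

/-- Fubini in the sign variable: one half of the second factor contributes the law of `f`, the other
that of `-f`. -/
lemma map_mul_bernoulliR {f : I → ℝ} (hf : AEMeasurable f volume) :
    (volume : Measure (I × I)).map (fun p => f p.1 * bernoulliR p.2) =
      symmLaw ((volume : Measure I).map f) := by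
  suffices H : ∀ f : I → ℝ, Measurable f →
      (volume : Measure (I × I)).map (fun p => f p.1 * bernoulliR p.2) =
        symmLaw ((volume : Measure I).map f) by
    rw [Measure.map_congr hf.ae_eq_mk, ← H _ hf.measurable_mk]
    refine Measure.map_congr ?_
    filter_upwards [Measure.quasiMeasurePreserving_fst.ae_eq hf.ae_eq_mk] with p hp
    simp only [Function.comp_apply] at hp
    rw [hp]
  clear hf f
  intro f hf
  have hm : Measurable fun p : I × I => f p.1 * bernoulliR p.2 :=
    (hf.comp measurable_fst).mul (measurable_bernoulliR.comp measurable_snd)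
  have hA : MeasurableSet {t : I | (t : ℝ) ≤ 1 / 2} :=
    measurableSet_le (by fun_prop) (by fun_prop)
  ext B hB
  rw [Measure.map_apply hm hB, symmLaw_apply _ hB, Measure.map_apply hf hB,
    Measure.map_apply hf (measurable_neg hB), Measure.volume_eq_prod,
    Measure.prod_apply_symm (hm hB), ← lintegral_add_compl _ hA,
    setLIntegral_congr_fun (g := fun _ => volume (f ⁻¹' B)) hA,
    setLIntegral_congr_fun (g := fun _ => volume (f ⁻¹' (Neg.neg ⁻¹' B))) hA.compl]
  · rw [setLIntegral_const, setLIntegral_const, volume_bernoulliR_pos, volume_bernoulliR_neg,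
      mul_add, mul_comm, mul_comm _ (2⁻¹ : ℝ≥0∞)]
  · intro y (hy : ¬ (y : ℝ) ≤ 1 / 2)
    dsimp only
    congr 1
    ext x
    simp only [mem_preimage, bernoulliR, if_neg hy, mul_neg, mul_one]
  · intro y (hy : (y : ℝ) ≤ 1 / 2)
    dsimp only
    congr 1
    ext x
    simp only [mem_preimage, bernoulliR, if_pos hy, mul_one]

lemma aemeasurable_comp_eval {n : ℕ} {f : I → ℝ} (hf : AEMeasurable f volume) (k : Fin n) :
    AEMeasurable (fun ω : Fin n → I × I => f (ω k).1 * bernoulliR (ω k).2) volume :=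
  (aemeasurable_mul_bernoulliR hf).comp_quasiMeasurePreserving
    (measurePreserving_eval (fun _ : Fin n => (volume : Measure (I × I))) k).quasiMeasurePreserving

lemma aemeasurable_opA (n : ℕ) {f : I → ℝ} (hf : AEMeasurable f volume) :
    AEMeasurable (opA n f) volume :=
  Finset.aemeasurable_fun_sum _ fun k _ => aemeasurable_comp_eval hf k

lemma map_opA (n : ℕ) {f : I → ℝ} (hf : AEMeasurable f volume) :
    (volume : Measure (Fin n → I × I)).map (opA n f) =
      convPow (symmLaw ((volume : Measure I).map f)) n := by
  have h := map_sum_eq_convPow (symmLaw ((volume : Measure I).map f))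
    (P := (volume : Measure (Fin n → I × I)))
    (fun k => aemeasurable_comp_eval hf k)
    (iIndepFun_pi (μ := fun _ => (volume : Measure (I × I)))
      (X := fun (_ : Fin n) p => f p.1 * bernoulliR p.2) fun _ => aemeasurable_mul_bernoulliR hf)
    (fun k => ?_) Finset.univ
  · rw [Finset.card_univ, Fintype.card_fin] at h
    exact h
  · have hp := measurePreserving_eval (fun _ : Fin n => (volume : Measure (I × I))) k
    rw [← map_mul_bernoulliR hf]
    conv_rhs => rw [Measure.volume_eq_prod, ← Measure.volume_eq_prod, ← hp.map_eq]
    rw [AEMeasurable.map_map_of_aemeasurable _ hp.measurable.aemeasurable]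
    · rfl
    · rw [hp.map_eq]
      exact aemeasurable_mul_bernoulliR hf

variable (ψ : ConcaveWeight)

lemma lorentzNorm_opA_eq (n : ℕ) {f : I → ℝ} (hf : AEMeasurable f volume) :
    lorentzNorm ψ volume (opA n f) =
      lorentzNorm ψ (convPow (symmLaw ((volume : Measure I).map f)) n) id := by
  rw [← map_opA n hf, lorentzNorm_map ψ (aemeasurable_opA n hf)]

/-- The norm of `A_n f` depends only on `|f|`. -/
lemma lorentzNorm_opA_congr_abs (n : ℕ) {f g : I → ℝ} (hf : AEMeasurable f volume)
    (hg : AEMeasurable g volume) (h : ∀ᵐ x, |f x| = |g x|) :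
    lorentzNorm ψ volume (opA n f) = lorentzNorm ψ volume (opA n g) := by
  rw [lorentzNorm_opA_eq ψ n hf, lorentzNorm_opA_eq ψ n hg]
  congr 2
  ext B hB
  -- Written this way, the symmetrised law sees only the unordered pair `{f x, -f x}`.
  have key : ∀ f : I → ℝ, AEMeasurable f volume → symmLaw (volume.map f) B =
      2⁻¹ * ∫⁻ x, (B.indicator 1 (f x) + B.indicator 1 (-f x)) := by
    intro f hf
    have hB' := measurable_neg hB
    rw [symmLaw_apply _ hB, lintegral_add_left' ?_, ← lintegral_indicator_one hB,
      lintegral_map' (measurable_one.indicator hB).aemeasurable hf,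
      ← lintegral_indicator_one hB',
      lintegral_map' (measurable_one.indicator hB').aemeasurable hf]
    · rfl
    · exact (measurable_one.indicator hB).comp_aemeasurable hf
  rw [key f hf, key g hg]
  congr 1
  refine lintegral_congr_ae ?_
  filter_upwards [h] with x hx
  rcases abs_eq_abs.1 hx with h1 | h1
  · rw [h1]
  · rw [h1, neg_neg, add_comm]

lemma lorentzNorm_mul_bernoulliR {f : I → ℝ} :
    lorentzNorm ψ (volume : Measure (I × I)) (fun p => f p.1 * bernoulliR p.2) =
      lorentzNorm ψ volume f := by
  refine lorentzNorm_congr_measure _ ψ fun s _ => ?_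
  have h1 : ∀ t, |bernoulliR t| = 1 := fun t => by
    unfold bernoulliR; split_ifs <;> simp
  have h2 : {p : I × I | s < |f p.1 * bernoulliR p.2|} = {x | s < |f x|} ×ˢ univ := by
    ext p; simp [abs_mul, h1]
  rw [h2, Measure.volume_eq_prod, Measure.prod_prod, measure_univ, mul_one]

lemma lorentzNorm_opA_le_nat_mul (n : ℕ) {f : I → ℝ} (hf : AEMeasurable f volume) :
    lorentzNorm ψ volume (opA n f) ≤ n * lorentzNorm ψ volume f := by
  refine (lorentzNorm_sum_le ψ Finset.univ fun k _ => aemeasurable_comp_eval hf k).trans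
    (le_of_eq ?_)
  have : ∀ k : Fin n, lorentzNorm ψ volume
      (fun ω : Fin n → I × I => f (ω k).1 * bernoulliR (ω k).2) = lorentzNorm ψ volume f := by
    intro k
    have hp := measurePreserving_eval (fun _ : Fin n => (volume : Measure (I × I))) k
    rw [← lorentzNorm_mul_bernoulliR]
    have h1 := lorentzNorm_map ψ (aemeasurable_mul_bernoulliR hf)
    have h2 := lorentzNorm_map ψ (aemeasurable_comp_eval hf k)
    rw [← h1, ← h2]
    congr 1
    conv_rhs => rw [Measure.volume_eq_prod, ← Measure.volume_eq_prod, ← hp.map_eq]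
    rw [AEMeasurable.map_map_of_aemeasurable _ hp.measurable.aemeasurable]
    · rfl
    · rw [hp.map_eq]
      exact aemeasurable_mul_bernoulliR hf
  simp [this]

lemma opANorm_le_nat (n : ℕ) : opANorm ψ n ≤ n := by
  refine iSup_le fun f => iSup_le fun hf => iSup_le fun h1 => ?_
  refine (lorentzNorm_opA_le_nat_mul ψ n hf.1).trans ?_
  calc (n : ℝ≥0∞) * lorentzNorm ψ volume f ≤ n * 1 := by gcongr
    _ = n := mul_one _

lemma opANorm_ne_top (n : ℕ) : opANorm ψ n ≠ ∞ :=
  ((opANorm_le_nat ψ n).trans_lt (ENNReal.natCast_lt_top n)).ne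

lemma opA_const_mul (n : ℕ) (c : ℝ) (f : I → ℝ) :
    opA n (fun x => c * f x) = fun ω => c * opA n f ω := by
  ext ω
  simp [opA, Finset.mul_sum, mul_assoc]

lemma lorentzNorm_opA_le (n : ℕ) {f : I → ℝ} (hf : MemLorentz ψ volume f) :
    lorentzNorm ψ volume (opA n f) ≤ opANorm ψ n * lorentzNorm ψ volume f := by
  rcases eq_or_ne (lorentzNorm ψ volume f) 0 with h0 | h0
  · have := lorentzNorm_opA_le_nat_mul ψ n hf.1
    rw [h0, mul_zero] at this
    exact this.trans zero_le
  · set c := (lorentzNorm ψ volume f).toReal with hc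
    have hc0 : 0 < c := ENNReal.toReal_pos h0 hf.2.ne
    have hcf : ENNReal.ofReal c = lorentzNorm ψ volume f := ENNReal.ofReal_toReal hf.2.ne
    have h1 : lorentzNorm ψ volume (fun x => c⁻¹ * f x) = 1 := by
      rw [lorentzNorm_const_mul _ ψ (inv_pos.2 hc0), ← hcf, ← ENNReal.ofReal_mul (by positivity),
        inv_mul_cancel₀ hc0.ne', ENNReal.ofReal_one]
    have h2 : lorentzNorm ψ volume (opA n fun x => c⁻¹ * f x) ≤ opANorm ψ n :=
      le_iSup_of_le (fun x => c⁻¹ * f x) (le_iSup_of_le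
        ⟨hf.1.const_mul _, by rw [h1]; exact ENNReal.one_lt_top⟩ (le_iSup_of_le h1.le le_rfl))
    rw [opA_const_mul, lorentzNorm_const_mul _ ψ (inv_pos.2 hc0), ENNReal.ofReal_inv_of_pos hc0,
      hcf, mul_comm, ← div_eq_mul_inv, ENNReal.div_le_iff h0 hf.2.ne] at h2
    exact h2

lemma lorentzNorm_conv_le (α β : Measure ℝ) [IsProbabilityMeasure α] [IsProbabilityMeasure β] :
    lorentzNorm ψ (α ∗ β) id ≤ lorentzNorm ψ α id + lorentzNorm ψ β id := by
  rw [Measure.conv, lorentzNorm_map ψ (by fun_prop)]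
  refine (lorentzNorm_add_le ψ (by fun_prop) (by fun_prop)).trans (le_of_eq ?_)
  congr 1
  · rw [← lorentzNorm_map ψ (by fun_prop)]
    congr 1
    exact measurePreserving_fst.map_eq
  · rw [← lorentzNorm_map ψ (by fun_prop)]
    congr 1
    exact measurePreserving_snd.map_eq

lemma lorentzNorm_opA_le_opANorm (n : ℕ) {f : I → ℝ} (hf : MemLorentz ψ volume f)
    (h1 : lorentzNorm ψ volume f ≤ 1) : lorentzNorm ψ volume (opA n f) ≤ opANorm ψ n :=
  le_iSup_of_le f (le_iSup_of_le hf (le_iSup_of_le h1 le_rfl))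

lemma opANorm_add_le (m n : ℕ) : opANorm ψ (m + n) ≤ opANorm ψ m + opANorm ψ n := by
  refine iSup_le fun f => iSup_le fun hf => iSup_le fun h1 => ?_
  have := Measure.isProbabilityMeasure_map hf.1
  refine le_trans ?_ (add_le_add (lorentzNorm_opA_le_opANorm ψ m hf h1)
    (lorentzNorm_opA_le_opANorm ψ n hf h1))
  rw [lorentzNorm_opA_eq ψ _ hf.1, lorentzNorm_opA_eq ψ _ hf.1, lorentzNorm_opA_eq ψ _ hf.1,
    convPow_add]
  exact lorentzNorm_conv_le ψ _ _

/-- The law of `A_m f` is that of some `g` on `[0,1]`. It is symmetric, so symmetrising it again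
changes nothing, and `A_n g` has the law of `A_(mn) f`: a sum of `n` independent blocks of `m`
terms. -/
lemma opANorm_mul_le (m n : ℕ) : opANorm ψ (m * n) ≤ opANorm ψ m * opANorm ψ n := by
  refine iSup_le fun f => iSup_le fun hf => iSup_le fun h1 => ?_
  have := Measure.isProbabilityMeasure_map hf.1
  set α := convPow (symmLaw ((volume : Measure I).map f)) m with hα
  obtain ⟨g, hg, hgα⟩ := Measure.exists_measurable_map_eq α
  have hfα : lorentzNorm ψ volume g = lorentzNorm ψ volume (opA m f) := by
    rw [lorentzNorm_opA_eq ψ _ hf.1, ← lorentzNorm_map ψ hg.aemeasurable, hgα]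
  have hgm : lorentzNorm ψ volume g ≤ opANorm ψ m :=
    hfα.le.trans (lorentzNorm_opA_le_opANorm ψ m hf h1)
  have hg' : MemLorentz ψ volume g :=
    ⟨hg.aemeasurable, hgm.trans_lt (opANorm_ne_top ψ m).lt_top⟩
  have hsymm : symmLaw α = α := symmLaw_of_map_neg (map_neg_convPow _ (map_neg_symmLaw _) m)
  calc lorentzNorm ψ volume (opA (m * n) f) = lorentzNorm ψ volume (opA n g) := by
        rw [lorentzNorm_opA_eq ψ _ hf.1, lorentzNorm_opA_eq ψ _ hg.aemeasurable, hgα, hsymm,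
          convPow_mul]
    _ ≤ opANorm ψ n * lorentzNorm ψ volume g := lorentzNorm_opA_le ψ n hg'
    _ ≤ opANorm ψ m * opANorm ψ n := by
        rw [mul_comm]
        gcongr

end Operator

/-! ### Reduction of the operator norm to indicators. -/

section Extension

lemma sum_mul_le_setLIntegral {F : ℝ → ℝ≥0∞} (hF : Antitone F) {δ : ℝ} (hδ : 0 < δ) (M : ℕ) :
    ∑ i ∈ Finset.range M, ENNReal.ofReal δ * F (((i : ℝ) + 1) * δ) ≤
      ∫⁻ s in Ioi (0 : ℝ), F s := by
  refine le_trans ?_ (lintegral_mono_set (s := Ioc 0 (M * δ)) Ioc_subset_Ioi_self)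
  induction M with
  | zero => simp
  | succ M ih =>
    have h1 : (M : ℝ) * δ ≤ ((M + 1 : ℕ) : ℝ) * δ := by push_cast; nlinarith
    rw [← Ioc_union_Ioc_eq_Ioc (show 0 ≤ (M : ℝ) * δ by positivity) h1,
      lintegral_union measurableSet_Ioc (Ioc_disjoint_Ioc_of_le le_rfl), Finset.sum_range_succ]
    refine add_le_add ih ?_
    calc ENNReal.ofReal δ * F (((M : ℝ) + 1) * δ)
        = ∫⁻ s in Ioc ((M : ℝ) * δ) (((M + 1 : ℕ) : ℝ) * δ), F (((M : ℝ) + 1) * δ) := by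
          rw [setLIntegral_const, Real.volume_Ioc, mul_comm]
          congr 2
          push_cast
          ring
      _ ≤ _ := setLIntegral_mono' measurableSet_Ioc fun s hs => hF (by
          have := hs.2
          push_cast at this
          exact this)

/-- At mesh `1 / (m + 1)` the levels strictly below `x` number `⌈(m + 1) x⌉ - 1`, and `(m + 1)²`
levels reach height `m + 1`, which is enough once `x ≤ m`. The error is at most one mesh. -/
lemma tendsto_sum_layers {x : ℝ} (hx : 0 ≤ x) :
    Tendsto (fun m : ℕ => ∑ i ∈ Finset.range ((m + 1) ^ 2),
      ((m : ℝ) + 1)⁻¹ * (Ioi (((i : ℝ) + 1) * ((m : ℝ) + 1)⁻¹)).indicator (fun _ => (1 : ℝ)) x)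
      atTop (𝓝 x) := by
  have hsum : ∀ m : ℕ, x ≤ m → ∑ i ∈ Finset.range ((m + 1) ^ 2),
      ((m : ℝ) + 1)⁻¹ * (Ioi (((i : ℝ) + 1) * ((m : ℝ) + 1)⁻¹)).indicator (fun _ => (1 : ℝ)) x =
        ((m : ℝ) + 1)⁻¹ * ((⌈((m : ℝ) + 1) * x⌉₊ - 1 : ℕ) : ℝ) := by
    intro m hm
    rw [← Finset.mul_sum]
    congr 1
    have h1 : ∀ i : ℕ, (Ioi (((i : ℝ) + 1) * ((m : ℝ) + 1)⁻¹)).indicator (fun _ => (1 : ℝ)) x =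
        if i < ⌈((m : ℝ) + 1) * x⌉₊ - 1 then 1 else 0 := by
      intro i
      rw [indicator_apply]
      refine if_congr ?_ rfl rfl
      rw [mem_Ioi, ← div_eq_mul_inv, div_lt_iff₀ (by positivity), Nat.lt_sub_iff_add_lt,
        Nat.lt_ceil, mul_comm]
      push_cast
      rfl
    simp only [h1]
    rw [Finset.sum_boole]
    congr 1
    rw [show (Finset.range ((m + 1) ^ 2)).filter (fun i => i < ⌈((m : ℝ) + 1) * x⌉₊ - 1) =
      Finset.range (⌈((m : ℝ) + 1) * x⌉₊ - 1) from ?_, Finset.card_range]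
    have h2 : ⌈((m : ℝ) + 1) * x⌉₊ ≤ (m + 1) ^ 2 := by
      refine Nat.ceil_le.2 ?_
      push_cast
      nlinarith [(Nat.cast_nonneg m : (0 : ℝ) ≤ m)]
    ext i
    simp only [Finset.mem_filter, Finset.mem_range]
    omega
  have hlow : Tendsto (fun m : ℕ => x - 1 / ((m : ℝ) + 1)) atTop (𝓝 x) := by
    simpa using tendsto_const_nhds.sub (tendsto_one_div_add_atTop_nhds_zero_nat (𝕜 := ℝ))
  refine tendsto_of_tendsto_of_tendsto_of_le_of_le' hlow tendsto_const_nhds ?_ ?_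
  · filter_upwards [eventually_ge_atTop ⌈x⌉₊] with m hm
    rw [hsum m (Nat.ceil_le.1 hm), inv_mul_eq_div, le_div_iff₀ (by positivity), sub_mul,
      one_div, inv_mul_cancel₀ (by positivity)]
    have h3 := Nat.le_ceil (((m : ℝ) + 1) * x)
    have h4 : ⌈((m : ℝ) + 1) * x⌉₊ ≤ (⌈((m : ℝ) + 1) * x⌉₊ - 1) + 1 := by omega
    have h5 : (⌈((m : ℝ) + 1) * x⌉₊ : ℝ) ≤ ((⌈((m : ℝ) + 1) * x⌉₊ - 1 : ℕ) : ℝ) + 1 := by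
      exact_mod_cast h4
    linarith
  · filter_upwards [eventually_ge_atTop ⌈x⌉₊] with m hm
    rw [hsum m (Nat.ceil_le.1 hm), inv_mul_eq_div, div_le_iff₀' (by positivity)]
    rcases Nat.eq_zero_or_pos ⌈((m : ℝ) + 1) * x⌉₊ with h0 | h0
    · rw [h0]
      simpa using by positivity
    · refine (Nat.lt_ceil.1 ?_).le
      omega

variable (ψ : ConcaveWeight)

/-- The norm of `A_n` is determined by its values on indicator functions. -/
lemma opANorm_le_of_indicator (n : ℕ) (c : ℝ≥0∞)
    (h : ∀ E : Set I, MeasurableSet E →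
      lorentzNorm ψ volume (opA n (E.indicator fun _ => 1)) ≤ c * ψ.tail (volume E)) :
    opANorm ψ n ≤ c := by
  refine iSup_le fun f => iSup_le fun hf => iSup_le fun h1 => ?_
  set g : I → ℝ := fun x => |hf.1.mk f x| with hg
  have hgm : Measurable g := hf.1.measurable_mk.abs
  have hfg : ∀ᵐ x, |f x| = |g x| := by
    filter_upwards [hf.1.ae_eq_mk] with x hx
    rw [hg, abs_abs, hx]
  have hgn : lorentzNorm ψ volume g = lorentzNorm ψ volume f := by
    rw [hg, lorentzNorm_abs]
    exact (lorentzNorm_congr_ae _ ψ hf.1.ae_eq_mk).symm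
  rw [lorentzNorm_opA_congr_abs ψ n hf.1 hgm.aemeasurable hfg]
  -- Superlevel sets of `g`. The approximants `G m` are equally weighted sums of their indicators,
  -- so the triangle inequality bounds `A_n (G m)` by `c` times a lower Riemann sum of the layer
  -- integral of `g`. The Fatou property then passes to `g`.
  let E : ℕ → ℕ → Set I := fun m i => g ⁻¹' Ioi (((i : ℝ) + 1) * ((m : ℝ) + 1)⁻¹)
  have hE : ∀ m i, MeasurableSet (E m i) := fun m i => hgm measurableSet_Ioi
  have hEm : ∀ m i, Measurable ((E m i).indicator fun _ => (1 : ℝ)) := fun m i =>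
    measurable_const.indicator (hE m i)
  let G : ℕ → I → ℝ := fun m x => ∑ i ∈ Finset.range ((m + 1) ^ 2),
    ((m : ℝ) + 1)⁻¹ * (E m i).indicator (fun _ => (1 : ℝ)) x
  have hG : ∀ m, Measurable (G m) := fun m =>
    Finset.measurable_fun_sum _ fun i _ => (hEm m i).const_mul _
  have hGlim : ∀ x, Tendsto (fun m => G m x) atTop (𝓝 (g x)) := fun x =>
    tendsto_sum_layers (abs_nonneg _)
  have hopA : ∀ m, opA n (G m) = fun ω => ∑ i ∈ Finset.range ((m + 1) ^ 2),
      ((m : ℝ) + 1)⁻¹ * opA n ((E m i).indicator fun _ => (1 : ℝ)) ω := by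
    intro m
    ext ω
    simp only [opA, G, Finset.sum_mul, Finset.mul_sum]
    rw [Finset.sum_comm]
    simp only [mul_assoc]
  have hbound : ∀ m, lorentzNorm ψ volume (opA n (G m)) ≤ c * lorentzNorm ψ volume g := by
    intro m
    have hm : (0 : ℝ) < ((m : ℝ) + 1)⁻¹ := by positivity
    rw [hopA]
    refine (lorentzNorm_sum_le ψ _ fun i _ =>
      (aemeasurable_opA n (hEm m i).aemeasurable).const_mul _).trans ?_
    calc ∑ i ∈ Finset.range ((m + 1) ^ 2), lorentzNorm ψ volume
          (fun ω => ((m : ℝ) + 1)⁻¹ * opA n ((E m i).indicator fun _ => (1 : ℝ)) ω)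
        ≤ ∑ i ∈ Finset.range ((m + 1) ^ 2), c * (ENNReal.ofReal ((m : ℝ) + 1)⁻¹ *
            ψ.tail (volume {x | ((i : ℝ) + 1) * ((m : ℝ) + 1)⁻¹ < |g x|})) := by
          refine Finset.sum_le_sum fun i _ => ?_
          rw [lorentzNorm_const_mul _ ψ hm, mul_left_comm]
          gcongr
          refine (h _ (hE m i)).trans (le_of_eq ?_)
          congr 3
          ext x
          simp [E, hg]
      _ ≤ c * lorentzNorm ψ volume g := by
          rw [← Finset.mul_sum, lorentzNorm_eq_lintegral_tail]
          gcongr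
          exact sum_mul_le_setLIntegral (F := fun s => ψ.tail (volume {x | s < |g x|}))
            (ψ.monotone_tail.comp_antitone (antitone_measure_lt_abs _ g)) hm _
  refine (lorentzNorm_le_liminf ψ (f := fun m => opA n (G m))
    (fun m => aemeasurable_opA n (hG m).aemeasurable) (ae_of_all _ fun ω => ?_)).trans ?_
  · exact tendsto_finsetSum _ fun k _ => (hGlim _).mul_const _
  · refine (liminf_le_of_frequently_le'
      (Eventually.frequently (Eventually.of_forall hbound))).trans ?_
    rw [hgn]
    calc c * lorentzNorm ψ volume f ≤ c * 1 := by gcongr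
      _ = c := mul_one c

end Extension

/-! ### From one strict inequality `‖A_m‖ < m` to a power bound. -/

section PowerBound

variable (ψ : ConcaveWeight)

/-- Euclidean division `n = m k + r` gives `‖A_n‖ ≤ ‖A_m‖ ‖A_k‖ + m`, and induction on `n` follows
the base-`m` expansion. -/
lemma opANorm_le_rpow_of_le {m : ℕ} (hm : 2 ≤ m) {q : ℝ} (hq : 0 < q)
    (h : opANorm ψ m ≤ ENNReal.ofReal ((m : ℝ) ^ q)) :
    ∃ C : ℝ, 0 < C ∧ ∀ n : ℕ, 1 ≤ n → opANorm ψ n ≤ ENNReal.ofReal (C * (n : ℝ) ^ q) := by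
  set b : ℕ → ℝ := fun n => (opANorm ψ n).toReal with hb
  have hm1 : (1 : ℝ) < m := by exact_mod_cast hm
  have hmq : 1 < (m : ℝ) ^ q := Real.one_lt_rpow hm1 hq
  have hbm : b m ≤ (m : ℝ) ^ q := ENNReal.toReal_le_of_le_ofReal (by positivity) h
  have hb0 : ∀ n, 0 ≤ b n := fun n => ENNReal.toReal_nonneg
  have hbn : ∀ n, b n ≤ n := fun n => by
    have := ENNReal.toReal_mono (ENNReal.natCast_ne_top n) (opANorm_le_nat ψ n)
    simpa using this
  have hbadd : ∀ k n, b (k + n) ≤ b k + b n := fun k n => by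
    have := ENNReal.toReal_mono (ENNReal.add_ne_top.2 ⟨opANorm_ne_top ψ k, opANorm_ne_top ψ n⟩)
      (opANorm_add_le ψ k n)
    rwa [ENNReal.toReal_add (opANorm_ne_top ψ k) (opANorm_ne_top ψ n)] at this
  have hbmul : ∀ k n, b (k * n) ≤ b k * b n := fun k n => by
    have := ENNReal.toReal_mono (ENNReal.mul_ne_top (opANorm_ne_top ψ k) (opANorm_ne_top ψ n))
      (opANorm_mul_le ψ k n)
    rwa [ENNReal.toReal_mul] at this
  -- `D` solves `D m^q = D + m`: adding it to the left side of the induction hypothesis absorbs the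
  -- additive error `m` of each division.
  set D : ℝ := m / ((m : ℝ) ^ q - 1) with hD
  have hD0 : 0 < D := div_pos (by linarith) (by linarith)
  have hDm : D * ((m : ℝ) ^ q - 1) = m := div_mul_cancel₀ _ (by linarith)
  have key : ∀ n : ℕ, 1 ≤ n → b n + D ≤ (D + m) * (n : ℝ) ^ q := by
    intro n
    induction n using Nat.strong_induction_on with
    | _ n ih =>
      intro hn
      have hn1 : (1 : ℝ) ≤ n := by exact_mod_cast hn
      rcases lt_or_ge n m with hnm | hnm
      · have h1 : (1 : ℝ) ≤ (n : ℝ) ^ q := Real.one_le_rpow hn1 hq.le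
        have h2 : (n : ℝ) ≤ m := by exact_mod_cast hnm.le
        nlinarith [hbn n]
      · set k := n / m with hk
        have hk1 : 1 ≤ k := (Nat.one_le_div_iff (by omega)).2 hnm
        have hkn : k < n := Nat.div_lt_self (by omega) (by omega)
        have hdecomp : m * k + n % m = n := Nat.div_add_mod n m
        have hr : ((n % m : ℕ) : ℝ) ≤ m := by exact_mod_cast (Nat.mod_lt n (by omega)).le
        have h1 : b n ≤ b m * b k + m := by
          have h2 := hbadd (m * k) (n % m)
          rw [hdecomp] at h2
          linarith [hbmul m k, hbn (n % m)]
        have h3 := ih k hkn hk1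
        have h4 : ((m : ℝ) * k) ^ q ≤ (n : ℝ) ^ q := by
          refine Real.rpow_le_rpow (by positivity) ?_ hq.le
          exact_mod_cast Nat.mul_div_le n m
        rw [Real.mul_rpow (by positivity) (by positivity)] at h4
        have h5 : b m * b k ≤ (m : ℝ) ^ q * ((D + m) * (k : ℝ) ^ q - D) :=
          mul_le_mul hbm (by linarith) (hb0 k) (by positivity)
        have h6 := mul_le_mul_of_nonneg_left h4 (show 0 ≤ D + m by linarith)
        linarith
  refine ⟨D + m, by linarith, fun n hn => ?_⟩
  rw [← ENNReal.ofReal_toReal (opANorm_ne_top ψ n)]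
  exact ENNReal.ofReal_le_ofReal (by linarith [key n hn])

/-- As `q` increases to `1`, `m^q` tends to `m > c m`, so some `q < 1` already has `m^q > c m`. -/
lemma exists_rpow_bound_of_le_mul {m : ℕ} (hm : 2 ≤ m) {c : ℝ} (hc : c < 1)
    (h : opANorm ψ m ≤ ENNReal.ofReal (c * m)) :
    ∃ q ∈ Ico (1 / 2 : ℝ) 1, ∃ C : ℝ, 0 < C ∧
      ∀ n : ℕ, 1 ≤ n → opANorm ψ n ≤ ENNReal.ofReal (C * (n : ℝ) ^ q) := by
  have hm0 : (0 : ℝ) < m := by exact_mod_cast (show 0 < m by omega)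
  have hlim : Tendsto (fun q : ℝ => (m : ℝ) ^ q) (𝓝[<] 1) (𝓝 ((m : ℝ) ^ (1 : ℝ))) :=
    (Real.continuous_const_rpow hm0.ne').continuousAt.tendsto.mono_left nhdsWithin_le_nhds
  rw [Real.rpow_one] at hlim
  have h1 : ∀ᶠ q : ℝ in 𝓝[<] 1, c * m < (m : ℝ) ^ q := hlim.eventually (lt_mem_nhds (by nlinarith))
  have h2 : ∀ᶠ q : ℝ in 𝓝[<] 1, q ∈ Ico (1 / 2 : ℝ) 1 :=
    Ico_mem_nhdsLT (by norm_num)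
  obtain ⟨q, hq1, hq2⟩ := (h1.and h2).exists
  exact ⟨q, hq2, opANorm_le_rpow_of_le ψ hm (by linarith [hq2.1])
    (h.trans (ENNReal.ofReal_le_ofReal hq1.le))⟩

lemma exists_opANorm_lt_of_rpow_bound {q C : ℝ} (hq : q < 1)
    (h : ∀ n : ℕ, 1 ≤ n → opANorm ψ n ≤ ENNReal.ofReal (C * (n : ℝ) ^ q)) :
    ∃ n : ℕ, 1 ≤ n ∧ opANorm ψ n < n := by
  have hlim : Tendsto (fun n : ℕ => (n : ℝ) ^ (1 - q)) atTop atTop :=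
    (tendsto_rpow_atTop (by linarith)).comp tendsto_natCast_atTop_atTop
  obtain ⟨n, hn, hn1⟩ := ((hlim.eventually_gt_atTop C).and (eventually_ge_atTop 1)).exists
  have hn0 : (0 : ℝ) < n := by exact_mod_cast hn1
  refine ⟨n, hn1, (h n hn1).trans_lt ?_⟩
  rw [← ENNReal.ofReal_natCast, ENNReal.ofReal_lt_ofReal_iff hn0]
  have h1 : (n : ℝ) = (n : ℝ) ^ (1 - q) * (n : ℝ) ^ q := by
    rw [← Real.rpow_add hn0]; simp
  conv_rhs => rw [h1]
  exact mul_lt_mul_of_pos_right hn (by positivity)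

end PowerBound

/-! ### Independent identically distributed symmetric sequences. -/

section IID

variable (ψ : ConcaveWeight)

lemma lorentzNorm_sum_iid {ξ : ℕ → I → ℝ} (hξ : IsIIDSymmetric ψ ξ) (n : ℕ) :
    lorentzNorm ψ volume (fun t => ∑ k ∈ Finset.range n, ξ k t) =
      lorentzNorm ψ volume (opA n (ξ 0)) := by
  have hm : ∀ k, AEMeasurable (ξ k) volume := fun k => (hξ.mem k).1
  have hsymm : ((volume : Measure I).map (ξ 0)).map Neg.neg = (volume : Measure I).map (ξ 0) := by
    rw [AEMeasurable.map_map_of_aemeasurable measurable_neg.aemeasurable (hm 0)]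
    exact (hξ.symmetric 0).map_eq.symm
  rw [lorentzNorm_opA_eq ψ n (hm 0), symmLaw_of_map_neg hsymm,
    ← lorentzNorm_map ψ (Finset.aemeasurable_fun_sum _ fun k _ => hm k),
    map_sum_eq_convPow _ hm hξ.indep (fun k => (hξ.identDistrib k).map_eq), Finset.card_range]

/-- The infinite product of the symmetrised law of `f` is the law of some measurable map on `[0,1]`,
and its coordinates are the required variables. -/
lemma exists_iid_symmetric {f : I → ℝ} (hf : MemLorentz ψ volume f) :
    ∃ ξ : ℕ → I → ℝ, IsIIDSymmetric ψ ξ ∧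
      ∀ n, lorentzNorm ψ volume (opA n (ξ 0)) = lorentzNorm ψ volume (opA n f) := by
  have := Measure.isProbabilityMeasure_map hf.1
  set μ := symmLaw ((volume : Measure I).map f) with hμ
  obtain ⟨Φ, hΦ, hΦμ⟩ := Measure.exists_measurable_map_eq (Measure.infinitePi fun _ : ℕ => μ)
  have hm : ∀ k, Measurable fun t => Φ t k := fun k => (measurable_pi_apply k).comp hΦ
  have hlaw : ∀ k, (volume : Measure I).map (fun t => Φ t k) = μ := by
    intro k
    have h1 : (fun t => Φ t k) = (fun x : ℕ → ℝ => x k) ∘ Φ := rfl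
    rw [h1, ← Measure.map_map (measurable_pi_apply k) hΦ, hΦμ]
    exact (measurePreserving_eval_infinitePi (fun _ : ℕ => μ) k).map_eq
  have hneg : μ.map Neg.neg = μ := map_neg_symmLaw _
  have hnorm : ∀ k, lorentzNorm ψ volume (fun t => Φ t k) = lorentzNorm ψ volume f := by
    intro k
    rw [← lorentzNorm_map ψ (hm k).aemeasurable, hlaw, hμ, ← map_mul_bernoulliR hf.1,
      lorentzNorm_map ψ (aemeasurable_mul_bernoulliR hf.1), lorentzNorm_mul_bernoulliR]
  refine ⟨fun k t => Φ t k, ⟨fun k => ⟨(hm k).aemeasurable, ?_⟩, ?_, fun k => ?_, fun k => ?_⟩, ?_⟩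
  · rw [hnorm]; exact hf.2
  · rw [iIndepFun_iff_map_fun_eq_infinitePi_map hm]
    simp only [hlaw]
    exact hΦμ
  · exact ⟨(hm k).aemeasurable, (hm 0).aemeasurable, by rw [hlaw, hlaw]⟩
  · refine ⟨(hm k).aemeasurable, (hm k).neg.aemeasurable, ?_⟩
    have h2 : (fun t => -Φ t k) = Neg.neg ∘ fun t => Φ t k := rfl
    rw [h2, ← Measure.map_map measurable_neg (hm k), hlaw, hneg]
  · intro n
    rw [lorentzNorm_opA_eq ψ n (hm 0).aemeasurable, lorentzNorm_opA_eq ψ n hf.1, hlaw,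
      symmLaw_of_map_neg hneg]

end IID

/-! ### Indicators of intervals, and restriction of functions. -/

section Intervals

/-- The interval `(a, b]` as a subset of the unit interval. -/
def unitIoc (a b : ℝ) : Set I := {x | (x : ℝ) ∈ Ioc a b}

lemma measurableSet_unitIoc (a b : ℝ) : MeasurableSet (unitIoc a b) :=
  measurable_subtype_coe measurableSet_Ioc

lemma volume_unitIoc {a b : ℝ} (ha : 0 ≤ a) (hb : b ≤ 1) :
    (volume : Measure I) (unitIoc a b) = ENNReal.ofReal (b - a) := by
  rw [unitInterval.volume_apply]
  have : Subtype.val '' unitIoc a b = Ioc a b := by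
    ext x
    simp only [unitIoc, mem_image]
    constructor
    · rintro ⟨y, hy, rfl⟩
      exact hy
    · intro hx
      exact ⟨⟨x, ha.trans hx.1.le, hx.2.trans hb⟩, hx, rfl⟩
  rw [this, Real.volume_Ioc]

lemma measurable_indicator_unitIoc (a b : ℝ) :
    Measurable ((unitIoc a b).indicator fun _ => (1 : ℝ)) :=
  measurable_const.indicator (measurableSet_unitIoc a b)

variable (ψ : ConcaveWeight) (n : ℕ)

lemma tail_volume_unitIoc {a b : ℝ} (ha : 0 ≤ a) (hab : a ≤ b) (hb : b ≤ 1) :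
    ψ.tail (volume (unitIoc a b)) = ENNReal.ofReal (ψ (b - a)) := by
  rw [volume_unitIoc ha hb, ψ.tail_ofReal (by linarith) (by linarith)]

lemma memLorentz_indicator {E : Set I} (hE : MeasurableSet E) :
    MemLorentz ψ volume (E.indicator fun _ => (1 : ℝ)) :=
  ⟨(measurable_const.indicator hE).aemeasurable, by
    rw [lorentzNorm_indicator]; exact (ψ.tail_ne_top _).lt_top⟩

lemma lorentzNorm_opA_indicator_congr {E F : Set I} (hE : MeasurableSet E) (hF : MeasurableSet F)
    (h : volume E = volume F) :
    lorentzNorm ψ volume (opA n (E.indicator fun _ => 1)) =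
      lorentzNorm ψ volume (opA n (F.indicator fun _ => 1)) := by
  have hEm : Measurable (E.indicator fun _ => (1 : ℝ)) := measurable_const.indicator hE
  have hFm : Measurable (F.indicator fun _ => (1 : ℝ)) := measurable_const.indicator hF
  rw [lorentzNorm_opA_eq ψ n hEm.aemeasurable, lorentzNorm_opA_eq ψ n hFm.aemeasurable]
  congr 3
  ext B hB
  have hc : volume Eᶜ = volume Fᶜ := by
    rw [prob_compl_eq_one_sub hE, prob_compl_eq_one_sub hF, h]
  have key : ∀ A : Set I, (A.indicator fun _ => (1 : ℝ)) ⁻¹' B =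
      {x | (x ∈ A ∧ (1 : ℝ) ∈ B) ∨ (x ∈ Aᶜ ∧ (0 : ℝ) ∈ B)} := by
    intro A
    ext x
    by_cases hx : x ∈ A <;> simp [hx]
  rw [Measure.map_apply hEm hB, Measure.map_apply hFm hB, key, key]
  by_cases h1 : (1 : ℝ) ∈ B <;> by_cases h0 : (0 : ℝ) ∈ B <;> simp [h1, h0, em]
  · exact h
  · exact hc

lemma opA_add (f g : I → ℝ) : opA n (fun x => f x + g x) = fun ω => opA n f ω + opA n g ω := by
  ext ω
  simp [opA, add_mul, Finset.sum_add_distrib]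

/-- An interval of length `M v` splits into `M` pieces of length `v`, and only the length of a piece
matters. This allows a hump to be shrunk and moved at the price of a factor `M`. -/
lemma lorentzNorm_opA_indicator_mul_le (M : ℕ) {v a : ℝ} (hv : 0 ≤ v) (ha : 0 ≤ a)
    (hav : a + v ≤ 1) (hM : M * v ≤ 1) :
    lorentzNorm ψ volume (opA n ((unitIoc 0 (M * v)).indicator fun _ => 1)) ≤
      M * lorentzNorm ψ volume (opA n ((unitIoc a (a + v)).indicator fun _ => 1)) := by
  induction M with
  | zero =>
    have : opA n ((unitIoc 0 ((0 : ℕ) * v)).indicator fun _ => 1) = fun _ => 0 := by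
      ext ω
      simp [opA, unitIoc]
    rw [this, lorentzNorm_zero]
    exact zero_le
  | succ M ih =>
    have hM1 : (M : ℝ) * v + v ≤ 1 := by push_cast at hM; linarith
    have h0 : 0 ≤ (M : ℝ) * v := by positivity
    have hadd : ((unitIoc 0 ((M + 1 : ℕ) * v)).indicator fun _ => (1 : ℝ)) = fun x =>
        (unitIoc 0 (M * v)).indicator (fun _ => (1 : ℝ)) x +
          (unitIoc (M * v) (M * v + v)).indicator (fun _ => (1 : ℝ)) x := by
      have hu : unitIoc 0 ((M + 1 : ℕ) * v) =
          unitIoc 0 (M * v) ∪ unitIoc (M * v) (M * v + v) := by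
        have h1 := Ioc_union_Ioc_eq_Ioc h0 (show (M : ℝ) * v ≤ M * v + v by linarith)
        have h2 : ((M + 1 : ℕ) : ℝ) * v = M * v + v := by push_cast; ring
        ext x
        rw [h2]
        simp only [unitIoc, ← h1]
        rfl
      rw [hu, indicator_union_of_disjoint]
      exact disjoint_left.2 fun x hx hx' => not_lt.2 hx.2 hx'.1
    rw [hadd, opA_add]
    refine (lorentzNorm_add_le ψ (aemeasurable_opA n (measurable_indicator_unitIoc _ _).aemeasurable)
      (aemeasurable_opA n (measurable_indicator_unitIoc _ _).aemeasurable)).trans ?_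
    rw [Nat.cast_succ, add_mul, one_mul]
    refine add_le_add (ih (by linarith)) (le_of_eq ?_)
    refine lorentzNorm_opA_indicator_congr ψ n (measurableSet_unitIoc _ _)
      (measurableSet_unitIoc _ _) ?_
    rw [volume_unitIoc h0 hM1, volume_unitIoc ha hav]
    congr 1
    ring

/-- Restricting `f` to a subset does not increase the norm of `A_n f`. -/
lemma lorentzNorm_opA_indicator_le {E : Set I} (hE : MeasurableSet E) {f : I → ℝ}
    (hf : AEMeasurable f volume) :
    lorentzNorm ψ volume (opA n (E.indicator f)) ≤ lorentzNorm ψ volume (opA n f) := by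
  -- Flip the sign of `f` off `E`: then `|g| = |f|` and `f + g` is twice the restriction of `f`, so
  -- the triangle inequality suffices.
  set g : I → ℝ := fun x => 2 * E.indicator f x + -f x with hg
  have hgm : AEMeasurable g volume := ((hf.indicator hE).const_mul 2).add hf.neg
  have hfg : ∀ᵐ x, |g x| = |f x| := ae_of_all _ fun x => by
    by_cases hx : x ∈ E
    · simp only [hg, indicator_of_mem hx]
      congr 1
      ring
    · simp [hg, indicator_of_notMem hx]
  have h2 : (fun x => 2 * E.indicator f x) = fun x => f x + g x := by
    ext x
    simp only [hg]
    ring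
  have h3 := lorentzNorm_add_le ψ (aemeasurable_opA n hf) (aemeasurable_opA n hgm)
  rw [← opA_add, ← h2, opA_const_mul, lorentzNorm_const_mul _ ψ two_pos,
    lorentzNorm_opA_congr_abs ψ n hgm hf hfg, ← two_mul, ENNReal.ofReal_ofNat] at h3
  exact (ENNReal.mul_le_mul_iff_right two_ne_zero ENNReal.ofNat_ne_top).1 h3

end Intervals

/-! ### Uniform boundedness by a gliding hump. -/

section UniformBound

variable (ψ : ConcaveWeight)

lemma exists_indicator_lt_of_lt_opANorm {n : ℕ} {c : ℝ} (hc : 0 ≤ c)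
    (h : ENNReal.ofReal c < opANorm ψ n) :
    ∃ u : ℝ, 0 < u ∧ u ≤ 1 ∧ ENNReal.ofReal (c * ψ u) <
      lorentzNorm ψ volume (opA n ((unitIoc 0 u).indicator fun _ => 1)) := by
  by_contra! hcon
  refine absurd h (not_lt.2 (opANorm_le_of_indicator ψ n _ fun E hE => ?_))
  have hE1 : volume E ≤ 1 := prob_le_one
  have hEt : volume E ≠ ∞ := measure_ne_top _ _
  rcases eq_or_ne (volume E) 0 with h0 | h0
  · have h1 := lorentzNorm_opA_le_nat_mul ψ n (memLorentz_indicator ψ hE).1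
    rw [lorentzNorm_indicator, h0, ψ.tail_zero, mul_zero] at h1
    exact h1.trans zero_le
  · have hu0 : 0 < (volume E).toReal := ENNReal.toReal_pos h0 hEt
    have hu1 : (volume E).toReal ≤ 1 := toReal_prob_le_one E
    have h1 := hcon _ hu0 hu1
    rw [lorentzNorm_opA_indicator_congr ψ n hE (measurableSet_unitIoc 0 (volume E).toReal),
      ψ.tail_of_le_one hE1, ← ENNReal.ofReal_mul hc]
    · exact h1
    · rw [volume_unitIoc le_rfl hu1, sub_zero, ENNReal.ofReal_toReal hEt]

/-- A bad interval of length `v ≤ 1` is cut into `2^(i+1)` pieces so that one fits into the dyadic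
slot `(2^(-i-1), 2^(-i)]`. The factor lost is prepaid in the constant `2^(i+1) 4^i`. -/
lemma exists_hump {q : ℝ} (h : ∀ C : ℝ, 0 < C → ∃ n : ℕ, 1 ≤ n ∧
    ENNReal.ofReal (C * (n : ℝ) ^ q) < opANorm ψ n) (i : ℕ) :
    ∃ (n : ℕ) (u : ℝ), 1 ≤ n ∧ 0 < u ∧ u ≤ (1 / 2) ^ (i + 1) ∧
      ENNReal.ofReal (4 ^ i * (n : ℝ) ^ q * ψ u) ≤ lorentzNorm ψ volume
        (opA n ((unitIoc ((1 / 2) ^ (i + 1)) ((1 / 2) ^ (i + 1) + u)).indicator fun _ => 1)) := by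
  have hM : (0 : ℝ) < 2 ^ (i + 1) := by positivity
  obtain ⟨n, hn, hlt⟩ := h (2 ^ (i + 1) * 4 ^ i) (by positivity)
  obtain ⟨v, hv0, hv1, hv⟩ := exists_indicator_lt_of_lt_opANorm ψ (by positivity) hlt
  have hpow : (1 / 2 : ℝ) ^ (i + 1) = 1 / 2 ^ (i + 1) := by rw [div_pow, one_pow]
  have hhalf : (1 / 2 : ℝ) ^ (i + 1) ≤ 1 / 2 := by
    rw [pow_succ]
    have : (1 / 2 : ℝ) ^ i ≤ 1 := pow_le_one₀ (by norm_num) (by norm_num)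
    linarith
  have hu1 : v / 2 ^ (i + 1) ≤ (1 / 2) ^ (i + 1) := by
    rw [hpow]; gcongr
  have hMu : ((2 ^ (i + 1) : ℕ) : ℝ) * (v / 2 ^ (i + 1)) = v := by
    push_cast
    field_simp
  refine ⟨n, v / 2 ^ (i + 1), hn, by positivity, hu1, ?_⟩
  have h1 := lorentzNorm_opA_indicator_mul_le ψ n (2 ^ (i + 1)) (v := v / 2 ^ (i + 1))
    (a := (1 / 2) ^ (i + 1)) (by positivity) (by positivity) (by linarith) (by rw [hMu]; exact hv1)
  rw [hMu] at h1
  have hψ : ψ (v / 2 ^ (i + 1)) ≤ ψ v :=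
    ψ.mono (by positivity) (div_le_self hv0.le (one_le_pow₀ (by norm_num))) hv1
  have h2 : ENNReal.ofReal (2 ^ (i + 1)) * ENNReal.ofReal (4 ^ i * (n : ℝ) ^ q *
      ψ (v / 2 ^ (i + 1))) ≤ ENNReal.ofReal (2 ^ (i + 1)) * lorentzNorm ψ volume
        (opA n ((unitIoc ((1 / 2) ^ (i + 1))
          ((1 / 2) ^ (i + 1) + v / 2 ^ (i + 1))).indicator fun _ => 1)) := by
    rw [← ENNReal.ofReal_mul hM.le]
    refine le_trans (ENNReal.ofReal_le_ofReal ?_) (hv.le.trans (h1.trans (le_of_eq ?_)))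
    · rw [← mul_assoc, ← mul_assoc]
      gcongr
    · congr 1
      rw [← ENNReal.ofReal_natCast]
      push_cast
      rfl
  exact (ENNReal.mul_le_mul_iff_right (by simp) ENNReal.ofReal_ne_top).1 h2

/-- Uniform boundedness: pointwise bounds `C(f) n ^ q` for `A_n f` give a bound for the norms. -/
lemma opANorm_le_rpow_of_pointwise {q : ℝ}
    (h : ∀ f : I → ℝ, MemLorentz ψ volume f → ∃ C : ℝ, 0 < C ∧
      ∀ n : ℕ, 1 ≤ n → lorentzNorm ψ volume (opA n f) ≤ ENNReal.ofReal (C * (n : ℝ) ^ q)) :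
    ∃ C : ℝ, 0 < C ∧ ∀ n : ℕ, 1 ≤ n → opANorm ψ n ≤ ENNReal.ofReal (C * (n : ℝ) ^ q) := by
  by_contra! hcon
  choose n u hn hu0 hu1 hnu using exists_hump ψ hcon
  set E : ℕ → Set I := fun i => unitIoc ((1 / 2) ^ (i + 1)) ((1 / 2) ^ (i + 1) + u i) with hE
  have hEm : ∀ i, MeasurableSet (E i) := fun i => measurableSet_unitIoc _ _
  have hpow : ∀ i : ℕ, (1 / 2 : ℝ) ^ (i + 1) ≤ 1 / 2 := fun i => by
    rw [pow_succ]
    have : (1 / 2 : ℝ) ^ i ≤ 1 := pow_le_one₀ (by norm_num) (by norm_num)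
    linarith
  have hu1' : ∀ i, u i ≤ 1 := fun i => by linarith [hpow i, hu1 i]
  have hψ : ∀ i, 0 < ψ (u i) := fun i => ψ.pos (hu0 i) (hu1' i)
  have hdisj : ∀ i j x, x ∈ E i → x ∈ E j → i = j := by
    have : ∀ i j x, x ∈ E i → x ∈ E j → ¬ i < j := by
      intro i j x hi hj hij
      have h1 : (1 / 2 : ℝ) ^ (j + 1) + u j ≤ (1 / 2) ^ j := by
        have := hu1 j
        rw [pow_succ] at this ⊢
        linarith
      have h2 : (1 / 2 : ℝ) ^ j ≤ (1 / 2) ^ (i + 1) :=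
        pow_le_pow_of_le_one (by norm_num) (by norm_num) hij
      linarith [hi.1, hj.2]
    intro i j x hi hj
    exact le_antisymm (not_lt.1 (this j i x hj hi)) (not_lt.1 (this i j x hi hj))
  -- The `i`-th summand of `f` has norm `2^(-i)`, so `f` has norm at most `2`, while restricting to
  -- `E i` leaves `A_(n i) f` of norm at least `2^(-i) 4^i = 2^i` times `(n i)^q`.
  set c : ℕ → ℝ := fun i => (1 / 2) ^ i / ψ (u i) with hc
  have hc0 : ∀ i, 0 < c i := fun i => div_pos (by positivity) (hψ i)
  set F : ℕ → I → ℝ := fun N x => ∑ i ∈ Finset.range N, c i * (E i).indicator (fun _ => 1) x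
    with hF
  set f : I → ℝ := fun x => ∑' i, c i * (E i).indicator (fun _ => 1) x with hf
  have hsingle : ∀ i x, x ∈ E i → ∀ j, j ≠ i → c j * (E j).indicator (fun _ => (1 : ℝ)) x = 0 := by
    intro i x hx j hj
    rw [indicator_of_notMem fun hx' => hj (hdisj j i x hx' hx), mul_zero]
  have hfE : ∀ i, (E i).indicator f = fun x => c i * (E i).indicator (fun _ => 1) x := by
    intro i
    ext x
    by_cases hx : x ∈ E i
    · rw [indicator_of_mem hx, hf]
      exact tsum_eq_single i (hsingle i x hx)
    · simp [indicator_of_notMem hx]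
  have hsummable : ∀ x, Summable fun i => c i * (E i).indicator (fun _ => (1 : ℝ)) x := by
    intro x
    by_cases hx : ∃ i, x ∈ E i
    · obtain ⟨i, hx⟩ := hx
      exact (hasSum_single i (hsingle i x hx)).summable
    · push Not at hx
      simp only [indicator_of_notMem (hx _), mul_zero]
      exact summable_zero
  have hFm : ∀ N, Measurable (F N) := fun N =>
    Finset.measurable_fun_sum _ fun i _ => (measurable_const.indicator (hEm i)).const_mul _
  have hFlim : ∀ x, Tendsto (fun N => F N x) atTop (𝓝 (f x)) := fun x =>
    (hsummable x).hasSum.tendsto_sum_nat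
  have hfm : AEMeasurable f volume :=
    (measurable_of_tendsto_metrizable hFm (tendsto_pi_nhds.2 hFlim)).aemeasurable
  have hFn : ∀ N, lorentzNorm ψ volume (F N) ≤ ENNReal.ofReal 2 := by
    intro N
    refine (lorentzNorm_sum_le ψ _ fun i _ =>
      (measurable_const.indicator (hEm i)).aemeasurable.const_mul _).trans ?_
    have h1 : ∀ i, lorentzNorm ψ volume (fun x => c i * (E i).indicator (fun _ => 1) x) =
        ENNReal.ofReal ((1 / 2) ^ i) := by
      intro i
      rw [lorentzNorm_const_mul _ ψ (hc0 i), lorentzNorm_indicator,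
        tail_volume_unitIoc ψ (by positivity) (by linarith [hu0 i])
          (by linarith [hu1 i, hpow i]), ← ENNReal.ofReal_mul (hc0 i).le, add_sub_cancel_left,
        div_mul_cancel₀ _ (hψ i).ne']
    simp only [h1]
    rw [← ENNReal.ofReal_sum_of_nonneg fun i _ => by positivity]
    refine ENNReal.ofReal_le_ofReal ?_
    have h2 := summable_geometric_two.sum_le_tsum (Finset.range N) fun i _ => by positivity
    rwa [tsum_geometric_two] at h2
  have hfn : MemLorentz ψ volume f := by
    refine ⟨hfm, ((lorentzNorm_le_liminf ψ (fun N => (hFm N).aemeasurable)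
      (ae_of_all _ hFlim)).trans (liminf_le_of_frequently_le'
        (Eventually.frequently (Eventually.of_forall hFn)))).trans_lt ENNReal.ofReal_lt_top⟩
  obtain ⟨C, hC, hCn⟩ := h f hfn
  obtain ⟨i, hi⟩ := pow_unbounded_of_one_lt C one_lt_two
  have hni : (0 : ℝ) < (n i : ℝ) ^ q :=
    Real.rpow_pos_of_pos (by exact_mod_cast (hn i)) q
  have h1 := lorentzNorm_opA_indicator_le ψ (n i) (hEm i) hfm
  rw [hfE, opA_const_mul, lorentzNorm_const_mul _ ψ (hc0 i)] at h1
  have h2 : ENNReal.ofReal (c i) * ENNReal.ofReal (4 ^ i * (n i : ℝ) ^ q * ψ (u i)) ≤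
      ENNReal.ofReal (C * (n i : ℝ) ^ q) :=
    (mul_le_mul_right (hnu i) _).trans (h1.trans (hCn _ (hn i)))
  rw [← ENNReal.ofReal_mul (hc0 i).le, ENNReal.ofReal_le_ofReal_iff (by positivity)] at h2
  have h3 : c i * (4 ^ i * (n i : ℝ) ^ q * ψ (u i)) = 2 ^ i * (n i : ℝ) ^ q := by
    have h4 : (4 : ℝ) ^ i = 2 ^ i * 2 ^ i := by rw [← mul_pow]; norm_num
    have := (hψ i).ne'
    rw [hc, h4]
    simp only [one_div, inv_pow]
    field_simp
  rw [h3] at h2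
  exact absurd (le_of_mul_le_mul_right h2 hni) (not_le.2 hi)

end UniformBound

/-! ### Cancellation in signed sums. -/

section Signs

variable {ι : Type*} [Fintype ι] {x r : ι → ℝ}

lemma sum_mul_le_sub (hx : ∀ i, 0 ≤ x i) (hr : ∀ i, r i ≤ 1) {l : ι} (hl : r l = -1) :
    ∑ i, x i * r i ≤ ∑ i, x i - 2 * x l := by
  classical
  rw [← Finset.add_sum_erase _ _ (Finset.mem_univ l),
    ← Finset.add_sum_erase (a := l) _ x (Finset.mem_univ l), hl]
  have := Finset.sum_le_sum (s := Finset.univ.erase l) fun i _ =>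
    mul_le_of_le_one_right (hx i) (hr i)
  linarith

lemma abs_sum_mul_le_sum (hx : ∀ i, 0 ≤ x i) (hr : ∀ i, |r i| ≤ 1) :
    |∑ i, x i * r i| ≤ ∑ i, x i := by
  refine (Finset.abs_sum_le_sum_abs _ _).trans (Finset.sum_le_sum fun i _ => ?_)
  rw [abs_mul, abs_of_nonneg (hx i)]
  exact mul_le_of_le_one_right (hx i) (hr i)

/-- When both signs occur, the sum loses `2 x l` from above and its negative loses `2 x k`. -/
lemma abs_sum_mul_le_sub_min (hx : ∀ i, 0 ≤ x i) (hr : ∀ i, |r i| ≤ 1) {k l : ι} (hk : r k = 1)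
    (hl : r l = -1) : |∑ i, x i * r i| ≤ ∑ i, x i - 2 * min (x k) (x l) := by
  have h1 := sum_mul_le_sub hx (fun i => (abs_le.1 (hr i)).2) hl
  have h2 := sum_mul_le_sub (r := fun i => -r i) hx (fun i => by linarith [(abs_le.1 (hr i)).1])
    (l := k) (by rw [hk])
  simp only [mul_neg, Finset.sum_neg_distrib] at h2
  refine abs_le.2 ⟨?_, ?_⟩
  · linarith [min_le_left (x k) (x l)]
  · linarith [min_le_right (x k) (x l)]

end Signs

lemma abs_bernoulliR (t : I) : |bernoulliR t| = 1 := by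
  unfold bernoulliR; split_ifs <;> simp

lemma bernoulliR_eq (t : I) : bernoulliR t = 1 ∨ bernoulliR t = -1 := by
  unfold bernoulliR; split_ifs <;> simp

lemma volume_bernoulliR_eq_one : (volume : Measure I) {t | bernoulliR t = 1} = 2⁻¹ := by
  rw [← volume_bernoulliR_pos]
  congr 1
  ext t
  rw [mem_ofPred_eq, mem_ofPred_eq, bernoulliR]
  split_ifs with h
  · exact iff_of_true rfl h
  · exact iff_of_false (by norm_num) h

lemma volume_bernoulliR_eq_neg_one : (volume : Measure I) {t | bernoulliR t = -1} = 2⁻¹ := by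
  rw [← volume_bernoulliR_neg]
  congr 1
  ext t
  rw [mem_ofPred_eq, mem_compl_iff, mem_ofPred_eq, bernoulliR]
  split_ifs with h
  · exact iff_of_false (by norm_num) (not_not_intro h)
  · exact iff_of_true rfl h

/-! ### Tail estimates for `A_n` on indicators. -/

section Tails

variable {n : ℕ}

lemma volume_forall_mem (A : Fin n → Set (I × I)) :
    (volume : Measure (Fin n → I × I)) {ω | ∀ k, ω k ∈ A k} = ∏ k, volume (A k) := by
  rw [← Measure.pi_pi, volume_pi]
  congr 1
  ext ω
  simp

lemma volume_prod_univ (E : Set I) :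
    (volume : Measure (I × I)) (E ×ˢ univ) = volume E := by
  rw [Measure.volume_eq_prod, Measure.prod_prod, measure_univ, mul_one]

lemma volume_univ_prod (E : Set I) :
    (volume : Measure (I × I)) (univ ×ˢ E) = volume E := by
  rw [Measure.volume_eq_prod, Measure.prod_prod, measure_univ, one_mul]

/-- The number of coordinates that fall into `E`. -/
noncomputable def hits (E : Set I) (ω : Fin n → I × I) : ℝ :=
  ∑ k, E.indicator (fun _ => (1 : ℝ)) (ω k).1

lemma indicator_one_nonneg (E : Set I) (x : I) : 0 ≤ E.indicator (fun _ => (1 : ℝ)) x :=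
  indicator_nonneg (fun _ _ => zero_le_one) x

lemma indicator_one_le (E : Set I) (x : I) : E.indicator (fun _ => (1 : ℝ)) x ≤ 1 :=
  indicator_le' (fun _ _ => le_rfl) (fun _ _ => zero_le_one) x

lemma abs_opA_indicator_le_hits (E : Set I) (ω : Fin n → I × I) :
    |opA n (E.indicator fun _ => 1) ω| ≤ hits E ω :=
  abs_sum_mul_le_sum (fun _ => indicator_one_nonneg E _) fun _ => (abs_bernoulliR _).le

lemma hits_eq_card [DecidablePred (· ∈ (E : Set I))] (ω : Fin n → I × I) :
    hits E ω = (Finset.univ.filter fun k => (ω k).1 ∈ E).card := by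
  rw [hits, ← Finset.sum_boole]
  exact Finset.sum_congr rfl fun k _ => by rw [indicator_apply]

lemma hits_le (E : Set I) (ω : Fin n → I × I) : hits E ω ≤ n := by
  classical
  rw [hits_eq_card]
  exact_mod_cast (Finset.card_le_univ _).trans (by simp)

lemma abs_opA_indicator_le (E : Set I) (ω : Fin n → I × I) :
    |opA n (E.indicator fun _ => 1) ω| ≤ n :=
  (abs_opA_indicator_le_hits E ω).trans (hits_le E ω)

/-- A value above `j` needs at least `j + 1` hits. This is the union bound over the sets of `j + 1`
coordinates, at most `n^(j+1)` in number. -/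
lemma volume_lt_abs_opA_le_pow (E : Set I) (j : ℕ) :
    volume {ω : Fin n → I × I | (j : ℝ) < |opA n (E.indicator fun _ => 1) ω|} ≤
      (n * volume E) ^ (j + 1) := by
  classical
  have hsub : {ω : Fin n → I × I | (j : ℝ) < |opA n (E.indicator fun _ => 1) ω|} ⊆
      ⋃ t ∈ Finset.powersetCard (j + 1) (Finset.univ : Finset (Fin n)),
        {ω | ∀ k, ω k ∈ if k ∈ t then E ×ˢ univ else univ} := by
    intro ω (hω : (j : ℝ) < _)
    have h1 := hω.trans_le (abs_opA_indicator_le_hits E ω)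
    rw [hits_eq_card, Nat.cast_lt] at h1
    obtain ⟨t, ht, htc⟩ := Finset.exists_subset_card_eq (Nat.succ_le_iff.2 h1)
    refine mem_iUnion₂.2 ⟨t, Finset.mem_powersetCard.2 ⟨Finset.subset_univ _, htc⟩, fun k => ?_⟩
    split_ifs with hk
    · exact ⟨(Finset.mem_filter.1 (ht hk)).2, mem_univ _⟩
    · exact mem_univ _
  refine (measure_mono hsub).trans ((measure_biUnion_finset_le _ _).trans ?_)
  calc ∑ t ∈ Finset.powersetCard (j + 1) (Finset.univ : Finset (Fin n)),
        volume {ω : Fin n → I × I | ∀ k, ω k ∈ if k ∈ t then E ×ˢ univ else univ}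
      = ∑ t ∈ Finset.powersetCard (j + 1) (Finset.univ : Finset (Fin n)),
          (volume E) ^ (j + 1) := by
        refine Finset.sum_congr rfl fun t ht => ?_
        rw [volume_forall_mem]
        have : ∀ k, volume (if k ∈ t then E ×ˢ (univ : Set I) else univ) =
            if k ∈ t then volume E else 1 := fun k => by
          split_ifs
          · exact volume_prod_univ E
          · exact measure_univ
        simp only [this]
        rw [Finset.prod_ite_mem, Finset.univ_inter, Finset.prod_const,
          (Finset.mem_powersetCard.1 ht).2]
    _ ≤ (n * volume E) ^ (j + 1) := by
        rw [Finset.sum_const, Finset.card_powersetCard, Finset.card_univ, Fintype.card_fin,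
          nsmul_eq_mul, mul_pow]
        gcongr
        exact_mod_cast Nat.choose_le_pow n (j + 1)

/-- A value above `n - 1` forces all signs to agree: opposite signs at `k` and `l` either cancel two
hits or meet a coordinate outside `E`. The bound does not depend on `E`, which matters when `ψ` is
eventually constant. -/
lemma volume_pred_lt_abs_opA_le (E : Set I) :
    volume {ω : Fin n → I × I | ((n - 1 : ℕ) : ℝ) < |opA n (E.indicator fun _ => 1) ω|} ≤
      2 * 2⁻¹ ^ n := by
  have hsub : {ω : Fin n → I × I | ((n - 1 : ℕ) : ℝ) < |opA n (E.indicator fun _ => 1) ω|} ⊆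
      {ω | ∀ k, ω k ∈ univ ×ˢ {t | bernoulliR t = 1}} ∪
        {ω | ∀ k, ω k ∈ univ ×ˢ {t | bernoulliR t = -1}} := by
    intro ω hω
    by_contra hcon
    have hcon' : ¬ (∀ k, bernoulliR (ω k).2 = 1) ∧ ¬ (∀ k, bernoulliR (ω k).2 = -1) := by
      simpa [not_or] using hcon
    obtain ⟨⟨l, hl⟩, ⟨k, hk⟩⟩ := hcon'.imp not_forall.1 not_forall.1
    have hl' := (bernoulliR_eq (ω l).2).resolve_left hl
    have hk' := (bernoulliR_eq (ω k).2).resolve_right hk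
    have h1 := abs_sum_mul_le_sub_min (x := fun i => E.indicator (fun _ => (1 : ℝ)) (ω i).1)
      (r := fun i => bernoulliR (ω i).2) (fun i => indicator_one_nonneg E _)
      (fun i => (abs_bernoulliR _).le) hk' hl'
    have hB : ∀ i, hits E ω ≤ ((n - 1 : ℕ) : ℝ) + E.indicator (fun _ => (1 : ℝ)) (ω i).1 := by
      intro i
      rw [hits, ← Finset.add_sum_erase _ _ (Finset.mem_univ i), add_comm]
      gcongr
      refine (Finset.sum_le_card_nsmul _ _ 1 fun j _ => indicator_one_le E _).trans ?_
      simp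
    have h2 : ((n - 1 : ℕ) : ℝ) < |∑ i, E.indicator (fun _ => (1 : ℝ)) (ω i).1 *
      bernoulliR (ω i).2| := hω
    have h3 : 0 ≤ min (E.indicator (fun _ => (1 : ℝ)) (ω k).1)
      (E.indicator (fun _ => (1 : ℝ)) (ω l).1) :=
      le_min (indicator_one_nonneg E _) (indicator_one_nonneg E _)
    have h4 : hits E ω ≤ ((n - 1 : ℕ) : ℝ) + min (E.indicator (fun _ => (1 : ℝ)) (ω k).1)
        (E.indicator (fun _ => (1 : ℝ)) (ω l).1) := by
      rw [← min_add_add_left]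
      exact le_min (hB k) (hB l)
    rw [hits] at h4
    linarith
  refine (measure_mono hsub).trans ((measure_union_le _ _).trans ?_)
  rw [volume_forall_mem, volume_forall_mem, volume_univ_prod, volume_univ_prod,
    volume_bernoulliR_eq_one, volume_bernoulliR_eq_neg_one, Finset.prod_const, Finset.card_univ,
    Fintype.card_fin, two_mul]

lemma pow_le_volume_lt_abs_opA {E : Set I} {s : ℝ} (hs : s < n) :
    (volume E * 2⁻¹) ^ n ≤
      volume {ω : Fin n → I × I | s < |opA n (E.indicator fun _ => 1) ω|} := by
  have h1 : volume {ω : Fin n → I × I | ∀ k, ω k ∈ E ×ˢ {t | bernoulliR t = 1}} =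
      (volume E * 2⁻¹) ^ n := by
    rw [volume_forall_mem, Measure.volume_eq_prod, Measure.prod_prod, volume_bernoulliR_eq_one]
    simp
  rw [← h1]
  refine measure_mono fun ω hω => ?_
  have h2 : opA n (E.indicator fun _ => 1) ω = n := by
    rw [opA, Finset.sum_congr rfl (g := fun _ => (1 : ℝ))]
    · simp
    · intro k _
      rw [indicator_of_mem (hω k).1, show bernoulliR (ω k).2 = 1 from (hω k).2, one_mul]
  rw [mem_ofPred_eq, h2, abs_of_nonneg n.cast_nonneg]
  exact hs

/-- The event that exactly one coordinate hits `E` splits into `n` disjoint events, and on it the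
value is `±1`. -/
lemma mul_pow_le_volume_lt_abs_opA {E : Set I} (hE : MeasurableSet E) {s : ℝ} (hs : s < 1) :
    n * (volume E * volume Eᶜ ^ (n - 1)) ≤
      volume {ω : Fin n → I × I | s < |opA n (E.indicator fun _ => 1) ω|} := by
  classical
  set A : Fin n → Set (Fin n → I × I) := fun i =>
    {ω | ∀ k, ω k ∈ if k = i then E ×ˢ univ else Eᶜ ×ˢ univ} with hA
  have hAv : ∀ i, volume (A i) = volume E * volume Eᶜ ^ (n - 1) := by
    intro i
    rw [hA, volume_forall_mem, ← Finset.mul_prod_erase _ _ (Finset.mem_univ i), if_pos rfl,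
      volume_prod_univ, Finset.prod_congr rfl (g := fun _ => volume Eᶜ)]
    · simp
    · intro k hk
      rw [if_neg (Finset.ne_of_mem_erase hk), volume_prod_univ]
  have hAm : ∀ i, MeasurableSet (A i) := by
    intro i
    have : A i = ⋂ k, (fun ω : Fin n → I × I => ω k) ⁻¹'
        (if k = i then E ×ˢ univ else Eᶜ ×ˢ univ) := by
      ext ω
      simp [hA]
    rw [this]
    refine MeasurableSet.iInter fun k => measurable_pi_apply k ?_
    split_ifs
    · exact hE.prod MeasurableSet.univ
    · exact hE.compl.prod MeasurableSet.univ
  have hdisj : Pairwise (Function.onFun Disjoint A) := by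
    intro i j hij
    refine disjoint_left.2 fun ω hi hj => ?_
    have h1 := hi i
    have h2 := hj i
    rw [if_pos rfl] at h1
    rw [if_neg hij] at h2
    exact h2.1 h1.1
  have hU : volume (⋃ i, A i) = n * (volume E * volume Eᶜ ^ (n - 1)) := by
    rw [measure_iUnion hdisj hAm, tsum_fintype]
    simp [hAv]
  rw [← hU]
  refine measure_mono (iUnion_subset fun i ω hω => ?_)
  have h3 : opA n (E.indicator fun _ => 1) ω = bernoulliR (ω i).2 := by
    rw [opA, Finset.sum_eq_single i]
    · have h1 := hω i
      rw [if_pos rfl] at h1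
      rw [indicator_of_mem h1.1, one_mul]
    · intro k _ hk
      have h2 := hω k
      rw [if_neg hk] at h2
      rw [indicator_of_notMem h2.1, zero_mul]
    · simp
  rw [mem_ofPred_eq, h3, abs_bernoulliR]
  exact hs

lemma measurable_opA_indicator {E : Set I} (hE : MeasurableSet E) :
    Measurable (opA n (E.indicator fun _ => 1)) :=
  Finset.measurable_fun_sum _ fun k _ =>
    ((measurable_const.indicator hE).comp (measurable_fst.comp (measurable_pi_apply k))).mul
      (measurable_bernoulliR.comp (measurable_snd.comp (measurable_pi_apply k)))

lemma lintegral_hits {E : Set I} (hE : MeasurableSet E) :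
    ∫⁻ ω : Fin n → I × I, ENNReal.ofReal (hits E ω) = n * volume E := by
  have h1 : ∀ ω : Fin n → I × I, ENNReal.ofReal (hits E ω) =
      ∑ k, ((fun ω : Fin n → I × I => ω k) ⁻¹' (E ×ˢ univ)).indicator 1 ω := by
    intro ω
    rw [hits, ENNReal.ofReal_sum_of_nonneg fun k _ => indicator_one_nonneg E _]
    refine Finset.sum_congr rfl fun k _ => ?_
    by_cases hk : (ω k).1 ∈ E
    · rw [indicator_of_mem hk, indicator_of_mem (by exact ⟨hk, mem_univ _⟩)]
      simp
    · rw [indicator_of_notMem hk, indicator_of_notMem (fun h => hk h.1)]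
      simp
  have hm : ∀ k : Fin n, MeasurableSet ((fun ω : Fin n → I × I => ω k) ⁻¹' (E ×ˢ univ)) :=
    fun k => measurable_pi_apply k (hE.prod MeasurableSet.univ)
  simp only [h1]
  rw [lintegral_finsetSum _ fun k _ => measurable_one.indicator (hm k)]
  have h2 : ∀ k : Fin n, ∫⁻ ω : Fin n → I × I,
      ((fun ω : Fin n → I × I => ω k) ⁻¹' (E ×ˢ univ)).indicator 1 ω = volume E := by
    intro k
    rw [lintegral_indicator_one (hm k), ← volume_prod_univ]
    exact (measurePreserving_eval (fun _ : Fin n => (volume : Measure (I × I))) k).measure_preimage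
      (hE.prod MeasurableSet.univ).nullMeasurableSet
  simp [h2]

lemma sum_indicator_lt_le {y : ℝ} {b : ℕ} (hy : y ≤ b) (n : ℕ) :
    ∑ j ∈ Finset.range n, (Iio y).indicator (fun _ => (1 : ℝ)) (j : ℝ) ≤ b := by
  have h1 : ∀ j : ℕ, (Iio y).indicator (fun _ => (1 : ℝ)) (j : ℝ) ≤ if j < b then 1 else 0 := by
    intro j
    by_cases hj : (j : ℝ) < y
    · rw [indicator_of_mem (by exact hj), if_pos (by exact_mod_cast hj.trans_le hy)]
    · rw [indicator_of_notMem (by exact hj)]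
      split_ifs <;> norm_num
  refine (Finset.sum_le_sum fun j _ => h1 j).trans ?_
  rw [Finset.sum_boole]
  refine Nat.cast_le.2 ((Finset.card_le_card (t := Finset.range b) fun j hj => ?_).trans (by simp))
  exact Finset.mem_range.2 (Finset.mem_filter.1 hj).2

/-- Pointwise, the number of `j < n` below `|A_n χ_E|` is at most the number of hits, whose mean is
`n |E|`. The gain is the probability that the first two coordinates hit `E` with opposite signs and
cancel; it makes the later Jensen argument strict. -/
lemma sum_volume_lt_abs_opA_add_le (hn : 2 ≤ n) {E : Set I} (hE : MeasurableSet E) :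
    ∑ j ∈ Finset.range n,
        volume {ω : Fin n → I × I | (j : ℝ) < |opA n (E.indicator fun _ => 1) ω|} +
      (volume E * 2⁻¹) ^ 2 ≤ n * volume E := by
  classical
  have hr1 : MeasurableSet {t : I | bernoulliR t = 1} :=
    measurable_bernoulliR (measurableSet_singleton 1)
  have hr2 : MeasurableSet {t : I | bernoulliR t = -1} :=
    measurable_bernoulliR (measurableSet_singleton (-1))
  set k : Fin n := ⟨0, by omega⟩ with hk
  set l : Fin n := ⟨1, by omega⟩ with hl
  have hkl : k ≠ l := by simp [hk, hl]
  set A : Fin n → Set (I × I) := fun i => if i = k then E ×ˢ {t | bernoulliR t = 1} else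
    if i = l then E ×ˢ {t | bernoulliR t = -1} else univ with hA
  set V : Set (Fin n → I × I) := {ω | ∀ i, ω i ∈ A i} with hV
  have hVm : MeasurableSet V := by
    have : V = ⋂ i, (fun ω : Fin n → I × I => ω i) ⁻¹' A i := by
      ext ω
      simp [hV]
    rw [this]
    refine MeasurableSet.iInter fun i => measurable_pi_apply i ?_
    simp only [hA]
    split_ifs
    · exact hE.prod hr1
    · exact hE.prod hr2
    · exact MeasurableSet.univ
  have hVv : volume V = (volume E * 2⁻¹) ^ 2 := by
    rw [hV, volume_forall_mem, ← Finset.mul_prod_erase _ _ (Finset.mem_univ k),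
      ← Finset.mul_prod_erase _ _ (Finset.mem_erase.2 ⟨hkl.symm, Finset.mem_univ l⟩),
      Finset.prod_eq_one]
    · simp only [hA, if_neg hkl.symm, if_true]
      rw [Measure.volume_eq_prod, Measure.prod_prod, Measure.prod_prod, volume_bernoulliR_eq_one,
        volume_bernoulliR_eq_neg_one, mul_one, sq]
    · intro i hi
      have h1 := Finset.mem_erase.1 hi
      simp [hA, h1.1, (Finset.mem_erase.1 h1.2).1]
  have hm : ∀ j : ℕ, MeasurableSet
      {ω : Fin n → I × I | (j : ℝ) < |opA n (E.indicator fun _ => 1) ω|} := fun j =>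
    measurableSet_lt measurable_const (measurable_opA_indicator hE).abs
  rw [← hVv, ← lintegral_hits hE]
  simp only [← lintegral_indicator_one (hm _)]
  rw [← lintegral_indicator_one hVm,
    ← lintegral_finsetSum _ fun j _ => measurable_one.indicator (hm j),
    ← lintegral_add_right _ (measurable_one.indicator hVm)]
  refine lintegral_mono fun ω => ?_
  set y := |opA n (E.indicator fun _ => 1) ω| with hy
  have h1 : ∀ j : ℕ, {ω : Fin n → I × I |
      (j : ℝ) < |opA n (E.indicator fun _ => 1) ω|}.indicator (1 : (Fin n → I × I) → ℝ≥0∞) ω =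
        ENNReal.ofReal ((Iio y).indicator (fun _ => (1 : ℝ)) (j : ℝ)) := by
    intro j
    by_cases hj : (j : ℝ) < y
    · rw [indicator_of_mem (by exact hj), indicator_of_mem (by exact hj)]
      simp
    · rw [indicator_of_notMem (by exact hj), indicator_of_notMem (by exact hj)]
      simp
  have h2 : V.indicator (1 : (Fin n → I × I) → ℝ≥0∞) ω =
      ENNReal.ofReal (V.indicator (fun _ => (1 : ℝ)) ω) := by
    by_cases hω : ω ∈ V <;> simp [hω]
  simp only [h1, h2]
  rw [← ENNReal.ofReal_sum_of_nonneg fun j _ => indicator_nonneg (fun _ _ => zero_le_one) _,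
    ← ENNReal.ofReal_add (Finset.sum_nonneg fun j _ => indicator_nonneg (fun _ _ => zero_le_one) _)
      (indicator_nonneg (fun _ _ => zero_le_one) _)]
  refine ENNReal.ofReal_le_ofReal ?_
  by_cases hω : ω ∈ V
  · have hωk := hω k
    have hωl := hω l
    simp only [hA, if_true, if_neg hkl.symm] at hωk hωl
    have h3 := abs_sum_mul_le_sub_min (x := fun i => E.indicator (fun _ => (1 : ℝ)) (ω i).1)
      (r := fun i => bernoulliR (ω i).2) (fun i => indicator_one_nonneg E _)
      (fun i => (abs_bernoulliR _).le) hωk.2 hωl.2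
    simp only [indicator_of_mem hωk.1, indicator_of_mem hωl.1, min_self] at h3
    have h4 : y ≤ hits E ω - 2 * 1 := h3
    rw [indicator_of_mem hω, hits_eq_card]
    rw [hits_eq_card] at h4
    set c := (Finset.univ.filter fun k => (ω k).1 ∈ E).card
    -- Needed so that `c - 2` is a genuine subtraction. The cancellation saves two units of which
    -- one is used.
    have hc : 2 ≤ c := by
      have : (2 : ℝ) ≤ c := by linarith [abs_nonneg (opA n (E.indicator fun _ => 1) ω)]
      exact_mod_cast this
    have h5 := sum_indicator_lt_le (y := y) (b := c - 2) (by push_cast [hc]; linarith) n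
    push_cast [hc] at h5
    linarith
  · rw [indicator_of_notMem hω, add_zero, hits_eq_card]
    exact sum_indicator_lt_le ((abs_opA_indicator_le_hits E ω).trans (hits_eq_card ω).le) n

/-- The two functions can differ only if some coordinate lands in `(u, v]`, which has probability at
most `n (v - u)`. This gives the Lipschitz dependence on the measure of the set. -/
lemma volume_lt_abs_opA_le_add {u v : ℝ} (hu : 0 ≤ u) (hv : v ≤ 1) {E F : Set I}
    (hEF : ∀ x, x ∉ unitIoc u v → (x ∈ E ↔ x ∈ F)) (j : ℝ) :
    volume {ω : Fin n → I × I | j < |opA n (E.indicator fun _ => 1) ω|} ≤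
      volume {ω : Fin n → I × I | j < |opA n (F.indicator fun _ => 1) ω|} +
        ENNReal.ofReal (n * (v - u)) := by
  have hsub : {ω : Fin n → I × I | j < |opA n (E.indicator fun _ => 1) ω|} ⊆
      {ω : Fin n → I × I | j < |opA n (F.indicator fun _ => 1) ω|} ∪
        ⋃ k, (fun ω : Fin n → I × I => ω k) ⁻¹' (unitIoc u v ×ˢ univ) := by
    intro ω hω
    by_cases hcon : ∃ k, (ω k).1 ∈ unitIoc u v
    · obtain ⟨k, hk⟩ := hcon
      exact Or.inr (mem_iUnion.2 ⟨k, hk, mem_univ _⟩)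
    · push Not at hcon
      refine Or.inl ?_
      have : opA n (F.indicator fun _ => 1) ω = opA n (E.indicator fun _ => 1) ω := by
        refine Finset.sum_congr rfl fun k _ => ?_
        congr 1
        by_cases hk : (ω k).1 ∈ E
        · rw [indicator_of_mem hk, indicator_of_mem ((hEF _ (hcon k)).1 hk)]
        · rw [indicator_of_notMem hk,
            indicator_of_notMem fun h => hk ((hEF _ (hcon k)).2 h)]
      rw [mem_ofPred_eq, this]
      exact hω
  refine (measure_mono hsub).trans ((measure_union_le _ _).trans ?_)
  gcongr
  refine (measure_iUnion_fintype_le _ _).trans (le_of_eq ?_)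
  have h2 : ∀ k : Fin n, (volume : Measure (Fin n → I × I))
      ((fun ω : Fin n → I × I => ω k) ⁻¹' (unitIoc u v ×ˢ univ)) = ENNReal.ofReal (v - u) := by
    intro k
    rw [← volume_unitIoc hu hv, ← volume_prod_univ]
    exact (measurePreserving_eval (fun _ : Fin n => (volume : Measure (I × I))) k).measure_preimage
      ((measurableSet_unitIoc u v).prod MeasurableSet.univ).nullMeasurableSet
  simp only [h2]
  rw [Finset.sum_const, Finset.card_univ, Fintype.card_fin, nsmul_eq_mul,
    ENNReal.ofReal_mul n.cast_nonneg, ENNReal.ofReal_natCast]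

variable (ψ : ConcaveWeight)

lemma setLIntegral_le_sum {F : ℝ → ℝ≥0∞} (hF : Antitone F) (M : ℕ) :
    ∫⁻ s in Ioc (0 : ℝ) M, F s ≤ ∑ j ∈ Finset.range M, F j := by
  induction M with
  | zero => simp
  | succ M ih =>
    rw [← Ioc_union_Ioc_eq_Ioc (show (0 : ℝ) ≤ M by positivity)
      (show (M : ℝ) ≤ (M + 1 : ℕ) by simp),
      lintegral_union measurableSet_Ioc (Ioc_disjoint_Ioc_of_le le_rfl), Finset.sum_range_succ]
    refine add_le_add ih ?_
    calc ∫⁻ s in Ioc (M : ℝ) ((M + 1 : ℕ) : ℝ), F s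
        ≤ ∫⁻ s in Ioc (M : ℝ) ((M + 1 : ℕ) : ℝ), F M :=
          setLIntegral_mono' measurableSet_Ioc fun s hs => hF hs.1.le
      _ = F M := by simp

lemma lorentzNorm_opA_indicator_le_sum (E : Set I) :
    lorentzNorm ψ volume (opA n (E.indicator fun _ => 1)) ≤ ∑ j ∈ Finset.range n,
      ψ.tail (volume {ω : Fin n → I × I | (j : ℝ) < |opA n (E.indicator fun _ => 1) ω|}) := by
  rw [lorentzNorm_eq_lintegral_tail, lintegral_Ioi_zero_eq_add (c := n) n.cast_nonneg,
    setLIntegral_congr_fun (g := fun _ => 0) (s := Ioi (n : ℝ)) measurableSet_Ioi, lintegral_zero,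
    add_zero]
  · exact setLIntegral_le_sum (F := fun s => ψ.tail (volume
      {ω : Fin n → I × I | s < |opA n (E.indicator fun _ => 1) ω|}))
      (ψ.monotone_tail.comp_antitone (antitone_measure_lt_abs _ _)) n
  · intro s (hs : (n : ℝ) < s)
    dsimp only
    rw [show {ω : Fin n → I × I | s < |opA n (E.indicator fun _ => 1) ω|} = ∅ from ?_,
      measure_empty, ψ.tail_zero]
    exact eq_empty_iff_forall_notMem.2 fun ω hω =>
      absurd hω (not_lt.2 ((abs_opA_indicator_le E ω).trans hs.le))

lemma mul_tail_le_lorentzNorm {Ω : Type*} [MeasurableSpace Ω] {P : Measure Ω}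
    [IsProbabilityMeasure P] {f : Ω → ℝ} (m : ℕ) {p : ℝ≥0∞}
    (h : ∀ s : ℝ, s < m → p ≤ P {ω | s < |f ω|}) :
    m * ψ.tail p ≤ lorentzNorm ψ P f := by
  rw [lorentzNorm_eq_lintegral_tail]
  calc (m : ℝ≥0∞) * ψ.tail p = ∫⁻ s in Ioo (0 : ℝ) m, ψ.tail p := by simp [mul_comm]
    _ ≤ ∫⁻ s in Ioo (0 : ℝ) m, ψ.tail (P {ω | s < |f ω|}) :=
        setLIntegral_mono' measurableSet_Ioo fun s hs => ψ.monotone_tail (h s hs.2)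
    _ ≤ _ := lintegral_mono_set Ioo_subset_Ioi_self

end Tails

/-! ### The tail probabilities as functions of the measure `u`. -/

section TailProb

/-- The probability that `|A_n χ_{(0,u]}|` exceeds `j`. -/
noncomputable def tailProb (n j : ℕ) (u : ℝ) : ℝ :=
  (volume {ω : Fin n → I × I |
    (j : ℝ) < |opA n ((unitIoc 0 u).indicator fun _ => 1) ω|}).toReal

lemma tailProb_nonneg (n j : ℕ) (u : ℝ) : 0 ≤ tailProb n j u := ENNReal.toReal_nonneg

lemma tailProb_le_one (n j : ℕ) (u : ℝ) : tailProb n j u ≤ 1 := toReal_prob_le_one _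

lemma volume_unitIoc_zero {u : ℝ} (hu1 : u ≤ 1) :
    (volume : Measure I) (unitIoc 0 u) = ENNReal.ofReal u := by
  rw [volume_unitIoc le_rfl hu1, sub_zero]

lemma tailProb_le_pow (n j : ℕ) {u : ℝ} (hu : 0 ≤ u) (hu1 : u ≤ 1) :
    tailProb n j u ≤ (n * u) ^ (j + 1) := by
  refine ENNReal.toReal_le_of_le_ofReal (by positivity)
    ((volume_lt_abs_opA_le_pow _ j).trans (le_of_eq ?_))
  rw [volume_unitIoc_zero hu1, ENNReal.ofReal_pow (by positivity),
    ENNReal.ofReal_mul n.cast_nonneg, ENNReal.ofReal_natCast]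

lemma tailProb_pred_le (n : ℕ) (u : ℝ) : tailProb n (n - 1) u ≤ 2 * (1 / 2) ^ n := by
  refine ENNReal.toReal_le_of_le_ofReal (by positivity)
    ((volume_pred_lt_abs_opA_le _).trans (le_of_eq ?_))
  rw [ENNReal.ofReal_mul two_pos.le, ENNReal.ofReal_pow (by positivity), one_div,
    ENNReal.ofReal_inv_of_pos two_pos, ENNReal.ofReal_ofNat]

lemma sum_tailProb_le {n : ℕ} (hn : 2 ≤ n) {u : ℝ} (hu : 0 ≤ u) (hu1 : u ≤ 1) :
    ∑ j ∈ Finset.range n, tailProb n j u + (u / 2) ^ 2 ≤ n * u := by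
  have h := sum_volume_lt_abs_opA_add_le hn (measurableSet_unitIoc 0 u)
  have h2 : (volume (unitIoc 0 u) * 2⁻¹) ^ 2 = ENNReal.ofReal ((u / 2) ^ 2) := by
    rw [volume_unitIoc_zero hu1, ENNReal.ofReal_pow (by positivity), div_eq_mul_inv,
      ENNReal.ofReal_mul hu, ENNReal.ofReal_inv_of_pos two_pos, ENNReal.ofReal_ofNat]
  have h3 : (n : ℝ≥0∞) * volume (unitIoc 0 u) = ENNReal.ofReal (n * u) := by
    rw [volume_unitIoc_zero hu1, ENNReal.ofReal_mul n.cast_nonneg, ENNReal.ofReal_natCast]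
  rw [h2, h3] at h
  have h4 := ENNReal.toReal_le_of_le_ofReal (by positivity) h
  rw [ENNReal.toReal_add (ENNReal.sum_ne_top.2 fun j _ => measure_ne_top _ _)
    ENNReal.ofReal_ne_top, ENNReal.toReal_sum fun j _ => measure_ne_top _ _,
    ENNReal.toReal_ofReal (by positivity)] at h4
  exact h4

lemma abs_tailProb_sub_le (n j : ℕ) {u v : ℝ} (hu : 0 ≤ u) (huv : u ≤ v) (hv : v ≤ 1) :
    |tailProb n j v - tailProb n j u| ≤ n * (v - u) := by
  have hEF : ∀ x, x ∉ unitIoc u v → (x ∈ unitIoc 0 u ↔ x ∈ unitIoc 0 v) := by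
    intro x hx
    constructor
    · exact fun h => ⟨h.1, h.2.trans huv⟩
    · exact fun h => ⟨h.1, not_lt.1 fun h' => hx ⟨h', h.2⟩⟩
  have hnn : 0 ≤ (n : ℝ) * (v - u) := mul_nonneg n.cast_nonneg (by linarith)
  have key : ∀ E F : Set I, (∀ x, x ∉ unitIoc u v → (x ∈ E ↔ x ∈ F)) →
      (volume {ω : Fin n → I × I | (j : ℝ) < |opA n (E.indicator fun _ => 1) ω|}).toReal ≤
        (volume {ω : Fin n → I × I | (j : ℝ) < |opA n (F.indicator fun _ => 1) ω|}).toReal +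
          n * (v - u) := by
    intro E F h
    have h1 := ENNReal.toReal_mono (ENNReal.add_ne_top.2
      ⟨measure_ne_top _ _, ENNReal.ofReal_ne_top⟩) (volume_lt_abs_opA_le_add (n := n) hu hv h j)
    rwa [ENNReal.toReal_add (measure_ne_top _ _) ENNReal.ofReal_ne_top,
      ENNReal.toReal_ofReal hnn] at h1
  have h1 := key _ _ hEF
  have h2 := key _ _ fun x hx => (hEF x hx).symm
  exact abs_le.2 ⟨by unfold tailProb; linarith, by unfold tailProb; linarith⟩

lemma continuousOn_tailProb (n j : ℕ) : ContinuousOn (tailProb n j) (Icc 0 1) := by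
  refine LipschitzOnWith.continuousOn (K := n) (LipschitzOnWith.of_dist_le_mul fun u hu v hv => ?_)
  rw [Real.dist_eq, Real.dist_eq, NNReal.coe_natCast]
  rcases le_total u v with h | h
  · rw [abs_sub_comm, abs_sub_comm u, abs_of_nonneg (sub_nonneg.2 h)]
    exact abs_tailProb_sub_le n j hu.1 h hv.2
  · rw [abs_of_nonneg (sub_nonneg.2 h)]
    exact abs_tailProb_sub_le n j hv.1 h hu.2

end TailProb

/-! ### Upper bounds for `A_n` on indicators. -/

section Bounds

variable (ψ : ConcaveWeight)

lemma lorentzNorm_opA_unitIoc_le (n : ℕ) (u : ℝ) :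
    lorentzNorm ψ volume (opA n ((unitIoc 0 u).indicator fun _ => 1)) ≤
      ENNReal.ofReal (∑ j ∈ Finset.range n, ψ (tailProb n j u)) := by
  refine (lorentzNorm_opA_indicator_le_sum ψ _).trans (le_of_eq ?_)
  rw [ENNReal.ofReal_sum_of_nonneg fun j _ =>
    ψ.nonneg (tailProb_nonneg n j u) (tailProb_le_one n j u)]
  exact Finset.sum_congr rfl fun j _ => ψ.tail_of_le_one prob_le_one

lemma continuousOn_sum_weight_tailProb (n : ℕ) :
    ContinuousOn (fun u => ∑ j ∈ Finset.range n, ψ (tailProb n j u)) (Icc 0 1) :=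
  continuousOn_finsetSum _ fun j _ => ψ.continuousOn.comp (continuousOn_tailProb n j)
    fun u _ => ⟨tailProb_nonneg n j u, tailProb_le_one n j u⟩

/-- By Jensen the sum is at most `n ψ(a)`, where the mean `a` of the tail probabilities is strictly
below `u` by cancellation. -/
lemma sum_weight_tailProb_lt {n : ℕ} (hn : 2 ≤ n) (hψ : ψ (2 * (1 / 2) ^ n) < ψ 1) {u : ℝ}
    (hu : 0 < u) (hu1 : u ≤ 1) :
    ∑ j ∈ Finset.range n, ψ (tailProb n j u) < n * ψ u := by
  have hn0 : (0 : ℝ) < n := by exact_mod_cast (show 0 < n by omega)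
  set a : ℝ := ∑ j ∈ Finset.range n, (n : ℝ)⁻¹ • tailProb n j u with ha
  have hsum := sum_tailProb_le hn hu.le hu1
  have ha' : n * a = ∑ j ∈ Finset.range n, tailProb n j u := by
    rw [ha, ← Finset.smul_sum, smul_eq_mul, mul_inv_cancel_left₀ hn0.ne']
  have ha0 : 0 ≤ a := Finset.sum_nonneg fun j _ =>
    smul_nonneg (inv_nonneg.2 hn0.le) (tailProb_nonneg n j u)
  have hau : a < u := by
    have : 0 < (u / 2) ^ 2 := by positivity
    nlinarith
  have hJ := ψ.concaveOn.le_map_sum (t := Finset.range n) (w := fun _ => (n : ℝ)⁻¹)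
    (p := fun j => tailProb n j u) (fun _ _ => inv_nonneg.2 hn0.le)
    (by simp [hn0.ne']) fun j _ => ⟨tailProb_nonneg n j u, tailProb_le_one n j u⟩
  rw [← Finset.smul_sum, smul_eq_mul, inv_mul_le_iff₀ hn0, ← ha] at hJ
  have hmono : ψ a ≤ ψ u := ψ.mono ha0 hau.le hu1
  rcases hmono.lt_or_eq with hlt | heq
  · exact hJ.trans_lt (mul_lt_mul_of_pos_left hlt hn0)
  -- A concave increasing function with `ψ a = ψ u`, `a < u`, is constant from `a` on. Jensen then
  -- gives nothing, but the term `j = n - 1` is strictly below `ψ 1` by `hψ`.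
  · have hu1' : ψ u = ψ 1 := by
      refine le_antisymm (ψ.mono hu.le hu1 le_rfl) ?_
      have ha1 : 0 < 1 - a := by linarith
      set t := (u - a) / (1 - a) with ht
      have ht0 : 0 < t := div_pos (by linarith) ha1
      have ht1 : t ≤ 1 := (div_le_one ha1).2 (by linarith)
      have h1 := ψ.concaveOn.2 (x := a) (y := 1) ⟨ha0, by linarith⟩ ⟨zero_le_one, le_rfl⟩
        (sub_nonneg.2 ht1) ht0.le (by ring)
      have h2 : (1 - t) • a + t • (1 : ℝ) = u := by
        have : t * (1 - a) = u - a := div_mul_cancel₀ _ ha1.ne'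
        simp only [smul_eq_mul]
        linarith
      rw [h2, heq] at h1
      simp only [smul_eq_mul] at h1
      exact le_of_mul_le_mul_left (by linarith) ht0
    rw [hu1']
    calc ∑ j ∈ Finset.range n, ψ (tailProb n j u) < ∑ j ∈ Finset.range n, ψ 1 := by
          refine Finset.sum_lt_sum (fun j _ => ψ.mono (tailProb_nonneg n j u)
            (tailProb_le_one n j u) le_rfl) ⟨n - 1, Finset.mem_range.2 (by omega), ?_⟩
          refine (ψ.mono (tailProb_nonneg n _ u) (tailProb_pred_le n u) ?_).trans_lt hψ
          have h3 : (1 / 2 : ℝ) ^ n ≤ (1 / 2) ^ 1 :=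
            pow_le_pow_of_le_one (by norm_num) (by norm_num) (by omega)
          linarith
      _ = n * ψ 1 := by simp

/-- Since `(nu)² ≤ u`, the tail probability is at most `u` for `j ≥ 1` and at most `u^l` for `j ≥ 2
l`. In units of `n ψ(u)`, the term `j = 0` costs `δ/4`, the terms with `j < 2 l` another `δ/4`, and
`1 - δ` is charged for all `j`; the total is `1 - δ/2`. -/
lemma sum_weight_tailProb_le_of_small {n l : ℕ} {δ u : ℝ} (hu : 0 < u)
    (hδ1 : δ ≤ 1) (hδ : 0 < δ) (hnu : (n : ℝ) ^ 2 * u ≤ 1) (hn : 1 ≤ n)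
    (h1 : ψ (n * u) ≤ δ / 4 * n * ψ u) (hl : ψ (u ^ l) ≤ (1 - δ) * ψ u)
    (hln : 2 * (l : ℝ) ≤ δ / 4 * n) :
    ∑ j ∈ Finset.range n, ψ (tailProb n j u) ≤ (1 - δ / 2) * n * ψ u := by
  have hn1 : (1 : ℝ) ≤ n := by exact_mod_cast hn
  have hnu0 : 0 ≤ (n : ℝ) * u := by positivity
  have hnu1 : (n : ℝ) * u ≤ 1 := by nlinarith
  have hu1 : u ≤ 1 := by nlinarith
  have hsq : ((n : ℝ) * u) ^ 2 ≤ u := by nlinarith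
  have hψu : 0 < ψ u := ψ.pos hu hu1
  have hterm : ∀ j ∈ Finset.range n, ψ (tailProb n j u) ≤
      (if j = 0 then δ / 4 * n * ψ u else 0) + (if j < 2 * l then ψ u else 0) +
        (1 - δ) * ψ u := by
    intro j _
    have hp := tailProb_le_pow n j hu.le hu1
    have hp0 := tailProb_nonneg n j u
    have hδψ : 0 ≤ (1 - δ) * ψ u := mul_nonneg (by linarith) hψu.le
    have h0 : 0 ≤ if j = 0 then δ / 4 * n * ψ u else 0 := by split_ifs <;> positivity
    have h0' : 0 ≤ if j < 2 * l then ψ u else 0 := by split_ifs <;> positivity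
    rcases Nat.eq_zero_or_pos j with hj | hj
    · have : ψ (tailProb n j u) ≤ ψ (n * u) := by
        subst hj
        exact ψ.mono hp0 (by simpa using hp) hnu1
      rw [if_pos hj]
      linarith
    · rcases lt_or_ge j (2 * l) with hjl | hjl
      · have : ψ (tailProb n j u) ≤ ψ u := by
          refine ψ.mono hp0 (hp.trans (le_trans ?_ hsq)) hu1
          exact pow_le_pow_of_le_one hnu0 hnu1 (by omega)
        rw [if_pos hjl]
        linarith
      · have : ψ (tailProb n j u) ≤ ψ (u ^ l) := by
          refine ψ.mono hp0 (hp.trans ?_) (pow_le_one₀ hu.le hu1)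
          calc ((n : ℝ) * u) ^ (j + 1) ≤ (n * u) ^ (2 * l) :=
                pow_le_pow_of_le_one hnu0 hnu1 (by omega)
            _ = ((n * u) ^ 2) ^ l := pow_mul _ _ _
            _ ≤ u ^ l := by gcongr
        linarith
  refine (Finset.sum_le_sum hterm).trans ?_
  rw [Finset.sum_add_distrib, Finset.sum_add_distrib, Finset.sum_ite_eq' _ 0,
    if_pos (Finset.mem_range.2 hn), ← Finset.sum_filter, Finset.sum_const, Finset.sum_const,
    Finset.card_range, nsmul_eq_mul, nsmul_eq_mul]
  have hcard : (((Finset.range n).filter fun j => j < 2 * l).card : ℝ) ≤ 2 * l := by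
    have : ((Finset.range n).filter fun j => j < 2 * l).card ≤ (Finset.range (2 * l)).card :=
      Finset.card_le_card fun j hj => Finset.mem_range.2 (Finset.mem_filter.1 hj).2
    rw [Finset.card_range] at this
    exact_mod_cast this
  have := mul_le_mul_of_nonneg_right (hcard.trans hln) hψu.le
  linarith

/-- Near `0` the constant `c` works. On the compact interval `[w, 1]` the continuous ratio attains
its maximum, which is below `1` by `sum_weight_tailProb_lt`. -/
lemma exists_sum_weight_tailProb_le {n : ℕ} (hn : 2 ≤ n) (hψ : ψ (2 * (1 / 2) ^ n) < ψ 1)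
    {c : ℝ} (hc : c < 1)
    (h : ∀ᶠ u in 𝓝[>] 0, ∑ j ∈ Finset.range n, ψ (tailProb n j u) ≤ c * n * ψ u) :
    ∃ c' < 1, 0 ≤ c' ∧ ∀ u, 0 < u → u ≤ 1 →
      ∑ j ∈ Finset.range n, ψ (tailProb n j u) ≤ c' * n * ψ u := by
  have hn0 : (0 : ℝ) < n := by exact_mod_cast (show 0 < n by omega)
  obtain ⟨v, hv, hvh⟩ := mem_nhdsGT_iff_exists_Ioo_subset.1 h
  have hv0 : 0 < v := hv
  set w := min (v / 2) 1 with hw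
  have hw0 : 0 < w := lt_min (by linarith) one_pos
  have hw1 : w ≤ 1 := min_le_right _ _
  have hcont : ContinuousOn (fun u => (∑ j ∈ Finset.range n, ψ (tailProb n j u)) / (n * ψ u))
      (Icc w 1) := by
    have hsub : Icc w 1 ⊆ Icc 0 1 := Icc_subset_Icc_left hw0.le
    refine ((continuousOn_sum_weight_tailProb ψ n).mono hsub).div
      (continuousOn_const.mul (ψ.continuousOn.mono hsub)) fun u hu => ?_
    exact (mul_pos hn0 (ψ.pos (hw0.trans_le hu.1) hu.2)).ne'
  obtain ⟨m, hm, hmax⟩ := isCompact_Icc.exists_isMaxOn ⟨w, le_rfl, hw1⟩ hcont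
  have hm0 := hw0.trans_le hm.1
  have hmψ := ψ.pos hm0 hm.2
  set c₁ := (∑ j ∈ Finset.range n, ψ (tailProb n j m)) / (n * ψ m) with hc₁
  have hc₁1 : c₁ < 1 :=
    (div_lt_one (mul_pos hn0 hmψ)).2 (sum_weight_tailProb_lt ψ hn hψ hm0 hm.2)
  have hc₁0 : 0 ≤ c₁ := div_nonneg (Finset.sum_nonneg fun j _ =>
    ψ.nonneg (tailProb_nonneg n j m) (tailProb_le_one n j m)) (by positivity)
  refine ⟨max c c₁, max_lt hc hc₁1, hc₁0.trans (le_max_right _ _), fun u hu hu1 => ?_⟩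
  have hψu := ψ.pos hu hu1
  rcases lt_or_ge u w with huw | huw
  · have huv : u < v := by linarith [min_le_left (v / 2) 1]
    refine (hvh ⟨hu, huv⟩ : _ ≤ _).trans ?_
    gcongr
    exact le_max_left _ _
  · have h1 : (∑ j ∈ Finset.range n, ψ (tailProb n j u)) / (n * ψ u) ≤ c₁ := hmax ⟨huw, hu1⟩
    rw [div_le_iff₀ (by positivity)] at h1
    refine h1.trans ?_
    rw [← mul_assoc]
    gcongr
    exact le_max_right _ _

lemma opANorm_le_of_sum_le {n : ℕ} {c : ℝ} (hc : 0 ≤ c)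
    (h : ∀ u, 0 < u → u ≤ 1 → ∑ j ∈ Finset.range n, ψ (tailProb n j u) ≤ c * n * ψ u) :
    opANorm ψ n ≤ ENNReal.ofReal (c * n) := by
  by_contra hcon
  obtain ⟨u, hu0, hu1, hu⟩ :=
    exists_indicator_lt_of_lt_opANorm ψ (mul_nonneg hc n.cast_nonneg) (not_le.1 hcon)
  exact absurd hu (not_lt.2 ((lorentzNorm_opA_unitIoc_le ψ n u).trans
    (ENNReal.ofReal_le_ofReal (h u hu0 hu1))))

end Bounds

/-! ### The growth conditions on the weight and the size of `‖A_n‖`. -/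

section Growth

variable (ψ : ConcaveWeight)

lemma eventually_small {v : ℝ} (hv : 0 < v) : ∀ᶠ u : ℝ in 𝓝[>] 0, 0 < u ∧ u < v :=
  Ioo_mem_nhdsGT hv

lemma eventually_ratio_nonneg {g : ℝ → ℝ} (hg : ∀ᶠ u in 𝓝[>] 0, g u ∈ Icc (0 : ℝ) 1) :
    ∀ᶠ u in 𝓝[>] 0, 0 ≤ ψ (g u) / ψ u := by
  filter_upwards [hg, eventually_small one_pos] with u h1 h2
  exact div_nonneg (ψ.nonneg h1.1 h1.2) (ψ.nonneg h2.1.le h2.2.le)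

lemma eventually_mul_mem (k : ℕ) : ∀ᶠ u : ℝ in 𝓝[>] 0, (k : ℝ) * u ∈ Icc (0 : ℝ) 1 := by
  have hk : (0 : ℝ) < (k + 1 : ℝ)⁻¹ := by positivity
  filter_upwards [eventually_small hk] with u hu
  refine ⟨mul_nonneg k.cast_nonneg hu.1.le, ?_⟩
  have := mul_lt_mul_of_pos_left hu.2 (show (0 : ℝ) < k + 1 by positivity)
  rw [mul_inv_cancel₀ (by positivity)] at this
  linarith [hu.1]

lemma eventually_pow_mem (l : ℕ) : ∀ᶠ u : ℝ in 𝓝[>] 0, u ^ l ∈ Icc (0 : ℝ) 1 := by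
  filter_upwards [eventually_small one_pos] with u hu
  exact ⟨pow_nonneg hu.1.le l, pow_le_one₀ hu.1.le hu.2.le⟩

/-- The real-valued `limsup` is an infimum that needs a lower bound to be meaningful; nonnegativity
of the ratio supplies it. -/
lemma limsup_ratio_le {g : ℝ → ℝ} (hg : ∀ᶠ u in 𝓝[>] 0, g u ∈ Icc (0 : ℝ) 1) {b : ℝ}
    (h : ∀ᶠ u in 𝓝[>] 0, ψ (g u) ≤ b * ψ u) :
    limsup (fun u => ψ (g u) / ψ u) (𝓝[>] 0) ≤ b := by
  refine limsup_le_of_le ?_ ?_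
  · exact IsBoundedUnder.isCoboundedUnder_le ⟨0, eventually_map.2 (eventually_ratio_nonneg ψ hg)⟩
  · filter_upwards [h, eventually_small one_pos] with u hu hu1
    rwa [div_le_iff₀ (ψ.pos hu1.1 hu1.2.le)]

lemma exists_eventually_le_of_limsup_ne {g : ℝ → ℝ}
    (hg : ∀ᶠ u in 𝓝[>] 0, g u ∈ Icc (0 : ℝ) 1) {b : ℝ} (hb : 0 < b)
    (h : ∀ᶠ u in 𝓝[>] 0, ψ (g u) ≤ b * ψ u)
    (hne : limsup (fun u => ψ (g u) / ψ u) (𝓝[>] 0) ≠ b) :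
    ∃ c : ℝ, 0 < c ∧ c < b ∧ ∀ᶠ u in 𝓝[>] 0, ψ (g u) ≤ c * ψ u := by
  have hlt := lt_of_le_of_ne (limsup_ratio_le ψ hg h) hne
  obtain ⟨c, hc, hcb⟩ := exists_between (max_lt hlt hb)
  have hbdd : IsBoundedUnder (· ≤ ·) (𝓝[>] 0) fun u => ψ (g u) / ψ u := by
    refine ⟨b, eventually_map.2 ?_⟩
    filter_upwards [h, eventually_small one_pos] with u hu hu1
    rwa [div_le_iff₀ (ψ.pos hu1.1 hu1.2.le)]
  refine ⟨c, (le_max_right _ _).trans_lt hc, hcb, ?_⟩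
  filter_upwards [eventually_lt_of_limsup_lt ((le_max_left _ _).trans_lt hc) hbdd,
    eventually_small one_pos] with u hu hu1
  exact (div_le_iff₀ (ψ.pos hu1.1 hu1.2.le)).1 hu.le

lemma eventually_weight_pow_mul_le {k : ℕ} (hk : 1 ≤ k) {c : ℝ} (hc : 0 < c)
    (h : ∀ᶠ u in 𝓝[>] 0, ψ (k * u) ≤ c * ψ u) (m : ℕ) :
    ∀ᶠ u in 𝓝[>] 0, ψ (((k ^ m : ℕ) : ℝ) * u) ≤ c ^ m * ψ u := by
  induction m with
  | zero => simp
  | succ m ih =>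
    have hkm : (0 : ℝ) < ((k ^ m : ℕ) : ℝ) := by exact_mod_cast Nat.pow_pos hk
    have hlim : Tendsto (fun u : ℝ => ((k ^ m : ℕ) : ℝ) * u) (𝓝[>] 0) (𝓝[>] 0) := by
      refine tendsto_nhdsWithin_iff.2 ⟨?_, ?_⟩
      · have : Tendsto (fun u : ℝ => ((k ^ m : ℕ) : ℝ) * u) (𝓝 0) (𝓝 (((k ^ m : ℕ) : ℝ) * 0)) :=
          (continuous_const_mul _).tendsto 0
        rw [mul_zero] at this
        exact this.mono_left nhdsWithin_le_nhds
      · filter_upwards [eventually_small one_pos] with u hu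
        exact mul_pos hkm hu.1
    filter_upwards [ih, hlim.eventually h] with u h1 h2
    have h3 : ((k ^ (m + 1) : ℕ) : ℝ) * u = k * (((k ^ m : ℕ) : ℝ) * u) := by
      push_cast
      ring
    rw [h3, pow_succ']
    refine h2.trans ?_
    rw [mul_assoc]
    gcongr

lemma tendsto_weight_two_mul_half_pow :
    Tendsto (fun n : ℕ => ψ (2 * (1 / 2) ^ n)) atTop (𝓝 0) := by
  have h1 : Tendsto (fun n : ℕ => 2 * (1 / 2 : ℝ) ^ n) atTop (𝓝[Icc 0 1] 0) := by
    refine tendsto_nhdsWithin_iff.2 ⟨?_, ?_⟩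
    · simpa using (tendsto_pow_atTop_nhds_zero_of_lt_one (r := (1 / 2 : ℝ))
        (by norm_num) (by norm_num)).const_mul 2
    · filter_upwards [eventually_ge_atTop 1] with n hn
      have : (1 / 2 : ℝ) ^ n ≤ (1 / 2) ^ 1 :=
        pow_le_pow_of_le_one (by norm_num) (by norm_num) hn
      exact ⟨by positivity, by linarith⟩
  have h2 := (ψ.continuousOn 0 ⟨le_rfl, zero_le_one⟩).tendsto.comp h1
  rw [ψ.map_zero] at h2
  exact h2

/-- Iterating the first hypothesis gives `ψ(k^m u) ≤ (c/k)^m k^m ψ(u)` near `0`. With `n = k^m` and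
`m` large, the factor `(c/k)^m` is below `δ/4`, the `2 l` middle terms are negligible against `n`,
and the nondegeneracy condition at `2 · 2^(-n)` holds. -/
lemma exists_opANorm_le_mul {k l : ℕ} (hk : 1 ≤ k) {c d : ℝ} (hc0 : 0 < c) (hck : c < k)
    (hd0 : 0 < d) (hd1 : d < 1) (hk' : ∀ᶠ u in 𝓝[>] 0, ψ (k * u) ≤ c * ψ u)
    (hl : ∀ᶠ u in 𝓝[>] 0, ψ (u ^ l) ≤ d * ψ u) :
    ∃ n : ℕ, 2 ≤ n ∧ ∃ c' < 1, opANorm ψ n ≤ ENNReal.ofReal (c' * n) := by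
  have hk2 : 2 ≤ k := by
    -- For `k = 1` the hypotheses would give `ψ u ≤ c ψ u` with `c < 1`.
    by_contra hcon
    have h1 : k = 1 := by omega
    subst h1
    obtain ⟨u, h1, h2⟩ := (hk'.and (eventually_small one_pos)).exists
    have h3 := ψ.pos h2.1 h2.2.le
    rw [Nat.cast_one] at hck
    rw [Nat.cast_one, one_mul] at h1
    nlinarith
  have hkR : (0 : ℝ) < k := by exact_mod_cast hk
  set δ := 1 - d with hδ
  have hδ0 : 0 < δ := by linarith
  have hpow : Tendsto (fun m : ℕ => k ^ m) atTop atTop := tendsto_pow_atTop_atTop_of_one_lt hk2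
  have e1 : ∀ᶠ m : ℕ in atTop, (c / k) ^ m < δ / 4 :=
    (tendsto_pow_atTop_nhds_zero_of_lt_one (by positivity)
      ((div_lt_one hkR).2 hck)).eventually (gt_mem_nhds (by positivity))
  have e2 : ∀ᶠ m : ℕ in atTop, 2 * (l : ℝ) / (δ / 4) ≤ ((k ^ m : ℕ) : ℝ) :=
    (tendsto_natCast_atTop_atTop.comp hpow).eventually_ge_atTop _
  have e3 : ∀ᶠ m : ℕ in atTop, ψ (2 * (1 / 2) ^ (k ^ m)) < ψ 1 :=
    ((tendsto_weight_two_mul_half_pow ψ).comp hpow).eventually (gt_mem_nhds ψ.map_one_pos)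
  have e4 : ∀ᶠ m : ℕ in atTop, 2 ≤ k ^ m := hpow.eventually_ge_atTop 2
  obtain ⟨m, h1, h2, h3, h4⟩ := (e1.and (e2.and (e3.and e4))).exists
  set n := k ^ m with hn
  have hn0 : (0 : ℝ) < n := by exact_mod_cast (show 0 < n by omega)
  have hsmall : ∀ᶠ u in 𝓝[>] 0, ∑ j ∈ Finset.range n, ψ (tailProb n j u) ≤
      (1 - δ / 2) * n * ψ u := by
    filter_upwards [eventually_weight_pow_mul_le ψ hk hc0 hk' m, hl,
      eventually_small (show (0 : ℝ) < ((n : ℝ) ^ 2)⁻¹ by positivity),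
      eventually_small one_pos] with u hu1 hu2 hu3 hu4
    have hψu := ψ.pos hu4.1 hu4.2.le
    refine sum_weight_tailProb_le_of_small ψ (l := l) hu3.1 (by linarith) hδ0 ?_ (by omega) ?_ ?_ ?_
    · have := mul_le_mul_of_nonneg_left hu3.2.le (show (0 : ℝ) ≤ (n : ℝ) ^ 2 by positivity)
      rwa [mul_inv_cancel₀ (by positivity)] at this
    · refine hu1.trans (mul_le_mul_of_nonneg_right ?_ hψu.le)
      have h5 : c ^ m = (c / k) ^ m * n := by
        rw [hn, div_pow]
        push_cast
        field_simp
      rw [h5]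
      gcongr
    · rw [hδ, sub_sub_cancel]
      exact hu2
    · rw [div_le_iff₀ (by positivity)] at h2
      linarith
  obtain ⟨c', hc'1, hc'0, hc'⟩ := exists_sum_weight_tailProb_le ψ h4 h3 (by linarith) hsmall
  exact ⟨n, h4, c', hc'1, opANorm_le_of_sum_le ψ hc'0 hc'⟩

lemma toReal_opANorm_mul_ge {n : ℕ} {u : ℝ} (hu : 0 < u) (hu1 : u ≤ 1) {x : ℝ} (hx : 0 ≤ x)
    (h : ENNReal.ofReal x ≤
      lorentzNorm ψ volume (opA n ((unitIoc 0 u).indicator fun _ => 1))) :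
    x ≤ (opANorm ψ n).toReal * ψ u := by
  have h1 := h.trans (lorentzNorm_opA_le ψ n (memLorentz_indicator ψ (measurableSet_unitIoc 0 u)))
  have hψ := ψ.nonneg hu.le hu1
  rw [lorentzNorm_indicator, tail_volume_unitIoc ψ le_rfl hu.le hu1, sub_zero,
    ← ENNReal.ofReal_toReal (opANorm_ne_top ψ n), ← ENNReal.ofReal_mul ENNReal.toReal_nonneg] at h1
  have := ENNReal.toReal_mono ENNReal.ofReal_ne_top h1
  rwa [ENNReal.toReal_ofReal hx, ENNReal.toReal_ofReal (by positivity)] at this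

/-- The one-hit event and concavity give `(1-u)^(n-1) ψ(nu) ≤ ‖A_n‖ ψ(u)`. As the first factor tends
to `1`, any `b` strictly between `‖A_n‖` and `n` would bound the limsup for `k = n`. -/
lemma nat_le_opANorm_of_limsup_mul
    (h : ∀ k : ℕ, 1 ≤ k → limsup (fun u : ℝ => ψ (k * u) / ψ u) (𝓝[>] 0) = k)
    {n : ℕ} (hn : 1 ≤ n) : (n : ℝ≥0∞) ≤ opANorm ψ n := by
  by_contra hcon
  set a := (opANorm ψ n).toReal with ha
  have hlt : a < n := by
    have := (ENNReal.toReal_lt_toReal (opANorm_ne_top ψ n) (ENNReal.natCast_ne_top n)).2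
      (not_le.1 hcon)
    simpa using this
  obtain ⟨b, hab, hbn⟩ := exists_between hlt
  have ha0 : 0 ≤ a := ENNReal.toReal_nonneg
  have hlim : Tendsto (fun u : ℝ => b * (1 - u) ^ (n - 1)) (𝓝[>] 0) (𝓝 b) := by
    have : Tendsto (fun u : ℝ => b * (1 - u) ^ (n - 1)) (𝓝 0) (𝓝 (b * (1 - 0) ^ (n - 1))) :=
      Continuous.tendsto (by fun_prop) 0
    simp only [sub_zero, one_pow, mul_one] at this
    exact this.mono_left nhdsWithin_le_nhds
  have hle : limsup (fun u : ℝ => ψ (n * u) / ψ u) (𝓝[>] 0) ≤ b := by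
    refine limsup_ratio_le ψ (eventually_mul_mem n) ?_
    filter_upwards [eventually_mul_mem n, eventually_small one_pos,
      hlim.eventually (lt_mem_nhds hab)] with u h1 h2 h3
    have hu1 : 0 < 1 - u := by linarith [h2.2]
    have hp0 : 0 < (1 - u) ^ (n - 1) := by positivity
    have hp1 : (1 - u) ^ (n - 1) ≤ 1 := pow_le_one₀ hu1.le (by linarith [h2.1])
    have hmul := ψ.mul_le hp0.le hp1 h1.1 h1.2
    have hψn := ψ.nonneg h1.1 h1.2
    have hvc : volume (unitIoc 0 u)ᶜ = ENNReal.ofReal (1 - u) := by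
      rw [prob_compl_eq_one_sub (measurableSet_unitIoc 0 u), volume_unitIoc_zero h2.2.le,
        ENNReal.ofReal_sub _ h2.1.le, ENNReal.ofReal_one]
    have h4 : ENNReal.ofReal (ψ ((1 - u) ^ (n - 1) * (n * u))) ≤
        lorentzNorm ψ volume (opA n ((unitIoc 0 u).indicator fun _ => 1)) := by
      have h5 := mul_tail_le_lorentzNorm ψ (f := opA n ((unitIoc 0 u).indicator fun _ => 1)) 1
        (fun s hs => mul_pow_le_volume_lt_abs_opA (measurableSet_unitIoc 0 u) (by simpa using hs))
      rw [Nat.cast_one, one_mul, hvc, volume_unitIoc_zero h2.2.le,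
        ← ENNReal.ofReal_pow hu1.le, ← ENNReal.ofReal_mul h2.1.le, ← ENNReal.ofReal_natCast,
        ← ENNReal.ofReal_mul n.cast_nonneg, ← mul_assoc, mul_comm,
        ψ.tail_ofReal (mul_nonneg hp0.le h1.1) (mul_le_one₀ hp1 h1.1 h1.2)] at h5
      exact h5
    have h6 := toReal_opANorm_mul_ge ψ h2.1 h2.2.le
      (ψ.nonneg (mul_nonneg hp0.le h1.1) (mul_le_one₀ hp1 h1.1 h1.2)) h4
    have hψu := ψ.pos h2.1 h2.2.le
    have h7 : (1 - u) ^ (n - 1) * ψ (n * u) ≤ (1 - u) ^ (n - 1) * (b * ψ u) := by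
      calc _ ≤ a * ψ u := hmul.trans h6
        _ ≤ b * (1 - u) ^ (n - 1) * ψ u := by gcongr
        _ = _ := by ring
    exact le_of_mul_le_mul_left h7 hp0
  rw [h n hn] at hle
  linarith

/-- The event of `n` hits with sign `+1` gives `n ψ((u/2)^n) ≤ ‖A_n‖ ψ(u)`, and `u² ≤ u/2` for `u ≤
1/2` replaces `(u/2)^n` by `u^(2n)`. The limsup for `l = 2 n` is thus at most `‖A_n‖ / n`. -/
lemma nat_le_opANorm_of_limsup_pow
    (h : ∀ l : ℕ, 1 ≤ l → limsup (fun u : ℝ => ψ (u ^ l) / ψ u) (𝓝[>] 0) = 1)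
    {n : ℕ} (hn : 1 ≤ n) : (n : ℝ≥0∞) ≤ opANorm ψ n := by
  by_contra hcon
  set a := (opANorm ψ n).toReal with ha
  have hn0 : (0 : ℝ) < n := by exact_mod_cast hn
  have hlt : a < n := by
    have := (ENNReal.toReal_lt_toReal (opANorm_ne_top ψ n) (ENNReal.natCast_ne_top n)).2
      (not_le.1 hcon)
    simpa using this
  have hle : limsup (fun u : ℝ => ψ (u ^ (2 * n)) / ψ u) (𝓝[>] 0) ≤ a / n := by
    refine limsup_ratio_le ψ (eventually_pow_mem _) ?_
    filter_upwards [eventually_small (show (0 : ℝ) < 1 / 2 by norm_num)] with u hu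
    have hu1 : u ≤ 1 := by linarith [hu.2]
    have h2 : u ^ (2 * n) ≤ (u / 2) ^ n := by
      rw [pow_mul]
      have := hu.1
      gcongr
      nlinarith [hu.2]
    have h3 : (u / 2) ^ n ≤ 1 := pow_le_one₀ (by linarith [hu.1]) (by linarith)
    have h30 : 0 ≤ (u / 2) ^ n := by have := hu.1; positivity
    have hψ := ψ.mono (pow_nonneg hu.1.le _) h2 h3
    have h4 : ENNReal.ofReal (n * ψ ((u / 2) ^ n)) ≤
        lorentzNorm ψ volume (opA n ((unitIoc 0 u).indicator fun _ => 1)) := by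
      have h5 := mul_tail_le_lorentzNorm ψ (f := opA n ((unitIoc 0 u).indicator fun _ => 1)) n
        (fun s hs => pow_le_volume_lt_abs_opA (E := unitIoc 0 u) hs)
      have h6 : (volume (unitIoc 0 u) * 2⁻¹) ^ n = ENNReal.ofReal ((u / 2) ^ n) := by
        rw [volume_unitIoc_zero hu1, ENNReal.ofReal_pow (by linarith [hu.1]), div_eq_mul_inv,
          ENNReal.ofReal_mul hu.1.le, ENNReal.ofReal_inv_of_pos two_pos, ENNReal.ofReal_ofNat]
      rw [h6, ψ.tail_ofReal h30 h3] at h5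
      rwa [ENNReal.ofReal_mul n.cast_nonneg, ENNReal.ofReal_natCast]
    have h7 := toReal_opANorm_mul_ge ψ hu.1 hu1
      (mul_nonneg n.cast_nonneg (ψ.nonneg h30 h3)) h4
    rw [div_mul_eq_mul_div, le_div_iff₀ hn0]
    nlinarith
  rw [h (2 * n) (by omega)] at hle
  rw [le_div_iff₀ hn0] at hle
  linarith

end Growth

/-! ### The dichotomy and the characterisation by i.i.d. sums. -/

theorem mainTheorem1 (ψ : ConcaveWeight) :
    Xor
      (∃ q ∈ Ico (1 / 2 : ℝ) 1, ∃ C : ℝ, 0 < C ∧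
        ∀ n : ℕ, 1 ≤ n → opANorm ψ n ≤ ENNReal.ofReal (C * (n : ℝ) ^ q))
      ((∀ k : ℕ, 1 ≤ k → limsup (fun u : ℝ => ψ (k * u) / ψ u) (𝓝[>] 0) = k) ∨
        (∀ l : ℕ, 1 ≤ l → limsup (fun u : ℝ => ψ (u ^ l) / ψ u) (𝓝[>] 0) = 1)) ∧
    ∀ q ∈ Ico (1 / 2 : ℝ) 1,
      (∃ C : ℝ, 0 < C ∧
        ∀ n : ℕ, 1 ≤ n → opANorm ψ n ≤ ENNReal.ofReal (C * (n : ℝ) ^ q)) ↔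
      (∀ ξ : ℕ → I → ℝ, IsIIDSymmetric ψ ξ → ∃ C : ℝ, 0 < C ∧
        ∀ n : ℕ, 1 ≤ n →
          lorentzNorm ψ volume (fun t => ∑ k ∈ Finset.range n, ξ k t) ≤
            ENNReal.ofReal (C * (n : ℝ) ^ q)) := by
  refine ⟨?_, fun q hq => ⟨?_, ?_⟩⟩
  · rw [xor_iff_iff_not]
    constructor
    · rintro ⟨q, hq, C, -, hC⟩ h2
      obtain ⟨n, hn, hlt⟩ := exists_opANorm_lt_of_rpow_bound ψ hq.2 hC
      rcases h2 with h2 | h2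
      · exact absurd hlt (not_lt.2 (nat_le_opANorm_of_limsup_mul ψ h2 hn))
      · exact absurd hlt (not_lt.2 (nat_le_opANorm_of_limsup_pow ψ h2 hn))
    · intro h2
      push Not at h2
      obtain ⟨⟨k, hk, hkne⟩, ⟨l, hl, hlne⟩⟩ := h2
      have hk0 : (0 : ℝ) < k := by exact_mod_cast hk
      obtain ⟨c, hc0, hck, hc⟩ := exists_eventually_le_of_limsup_ne ψ (eventually_mul_mem k) hk0
        ((eventually_mul_mem k).and (eventually_small one_pos) |>.mono fun u hu =>
          ψ.map_mul_le (by exact_mod_cast hk) hu.2.1.le hu.1.2) hkne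
      obtain ⟨d, hd0, hd1, hd⟩ := exists_eventually_le_of_limsup_ne ψ (eventually_pow_mem l) one_pos
        ((eventually_small one_pos).mono fun u hu => by
          rw [one_mul]
          exact ψ.mono (pow_nonneg hu.1.le l) (pow_le_of_le_one hu.1.le hu.2.le (by omega))
            hu.2.le) hlne
      obtain ⟨n, hn, c', hc', hle⟩ := exists_opANorm_le_mul ψ hk hc0 hck hd0 hd1 hc hd
      exact exists_rpow_bound_of_le_mul ψ hn hc' hle
  · rintro ⟨C, hC, hCn⟩ ξ hξ
    set a := (lorentzNorm ψ volume (ξ 0)).toReal with ha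
    have hat : ENNReal.ofReal a = lorentzNorm ψ volume (ξ 0) :=
      ENNReal.ofReal_toReal (hξ.mem 0).2.ne
    have ha0 : 0 ≤ a := ENNReal.toReal_nonneg
    -- Adding `1` keeps the constant positive when `ξ 0` has norm zero.
    refine ⟨C * (a + 1), by positivity, fun n hn => ?_⟩
    rw [lorentzNorm_sum_iid ψ hξ]
    refine (lorentzNorm_opA_le ψ n (hξ.mem 0)).trans ((mul_le_mul_left (hCn n hn) _).trans ?_)
    rw [← hat, ← ENNReal.ofReal_mul (by positivity)]
    refine ENNReal.ofReal_le_ofReal ?_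
    have : 0 ≤ C * (n : ℝ) ^ q := by positivity
    nlinarith
  · intro h
    refine opANorm_le_rpow_of_pointwise ψ fun f hf => ?_
    obtain ⟨ξ, hξ, hξf⟩ := exists_iid_symmetric ψ hf
    obtain ⟨C, hC, hCn⟩ := h ξ hξ
    refine ⟨C, hC, fun n hn => ?_⟩
    rw [← hξf, ← lorentzNorm_sum_iid ψ hξ]
    exact hCn n hn
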